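/- Let $\mathcal N$ be an infinite set of names, used for both calculi. **$\pi$-calculus.** Processes are $P::=0\mid P|P\mid {!P}\mid(\nu a)P\mid a(b).P\mid \bar a\langle b\rangle.P\mid\surd$, taken up to $\alpha$-equivalence. Structural equivalence $\equiv$ is the congruence generated by $P|0\equiv P$, commutativity and associativity of $|$, ${!P}\equiv P|{!P}$, $(\nu n)0\equiv0$, $(\nu n)(\nu m)P\equiv(\nu m)(\nu n)P$ and $P|(\nu n)Q\equiv(\nu n)(P|Q)$ if $n\notin\mathrm{fn}(P)$. Reduction $\to$ is generated by $a(b).P\,|\,\bar a\langle c\rangle.Q\to\{c/b\}P\,|\,Q$ and closed under parallel composition, restriction and $\equiv$. **Concurrent pattern calculus (CPC).** Patterns are $p::=\lambda x\mid x\mid\ulcorner x\urcorner\mid p\bullet p$ ($\bullet$ associates to the left); a pattern is communicable if it has no binding names $\lambda x$ and no protected names $\ulcorner x\urcorner$. Processes are as in the $\pi$-calculus, except that input and output are replaced by the case $p\to P$, where the binding names of $p$ are pairwise distinct and bind in $P$. Unification $\{p\|q\}$ is a partial operation whose result is a pair of substitutions of communicable patterns for names: $\{x\|x\}=\{x\|\ulcorner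 x\urcorner\}=\{\ulcorner x\urcorner\|x\}=\{\ulcorner x\urcorner\|\ulcorner x\urcorner\}=(\emptyset,\emptyset)$; $\{\lambda x\|q\}=(\{q/x\},\emptyset)$ if $q$ is communicable; $\{p\|\lambda x\}=(\emptyset,\{p/x\})$ if $p$ is communicable; $\{p_1\bullet p_2\|q_1\bullet q_2\}=(\sigma_1\cup\sigma_2,\rho_1\cup\rho_2)$ if $\{p_i\|q_i\}=(\sigma_i,\rho_i)$ for $i=1,2$; otherwise it is undefined. The relation $\equiv$ is defined as before, and $\to$ is generated by $(p\to P)|(q\to Q)\to\sigma P|\rho Q$ if $\{p\|q\}=(\sigma,\rho)$, with the same closure rules. The behavioural equivalence $\simeq$ is (strong) barbed congruence: the largest symmetric relation that is closed under reduction and under all contexts, and preserves top-level success as well as the barbs $P\downarrow_{\tilde m}$. Here $P\downarrow_{\tilde m}$ means that $P\equiv(\nu\tilde n)(p\to P'\,|\,P'')$ for some $\tilde n,p,P',P''$ such that no protected name of $p$ is in $\tilde n$ and $\tilde m=\mathrm{fn}(p)\setminus\tilde n$. In both calculi $\Rightarrow$ is the reflexive transitive closure of $\to$, $\to^\omega$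 denotes an infinite sequence of reductions, and $P\Downarrow$ means that $P\Rightarrow P'\equiv P''|\surd$ for some $P',P''$. **Homomorphisms.** An encoding of the $\pi$-calculus into CPC consists of a translation $[\![\cdot]\!]$ of $\pi$-processes into CPC processes and a renaming policy $\varphi$ that maps each name to a $k$-tuple of names, $k>0$. It is *valid* if 1. (compositionality) for every $j$-ary operator $\mathsf{op}$ of the $\pi$-calculus and every finite set $M$ of names there is a $j$-ary CPC context $C$ (each hole occurs exactly once) such that $[\![\mathsf{op}(S_1,\dots,S_j)]\!]=C([\![S_1]\!];\dots;[\![S_j]\!])$ whenever $\mathrm{fn}(S_1,\dots,S_j)=M$; 2. (name invariance) for every name substitution $\sigma$ (of finite domain) there is a name substitution $\sigma'$ with $\sigma'(\varphi(a))=\varphi(\sigma(a))$ for all names $a$, the identity on all names outside of the tuples $\varphi(a)$, such that for every $S$: $[\![\sigma S]\!]=\sigma'[\![S]\!]$ if $\sigma$ is injective, and $[\![\sigma S]\!]\simeq\sigma'[\![S]\!]$ otherwise; 3. (operational correspondence) if $S\Rightarrow S'$ then $[\![S]\!]\Rightarrow T\simeq[\![S']\!]$ for some $T$; and if $[\![S]\!]\Rightarrow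 T$ then there are $S',T'$ with $S\Rightarrow S'$ and $T\Rightarrow T'\simeq[\![S']\!]$; 4. (divergence reflection) if $[\![S]\!]\to^\omega$ then $S\to^\omega$; 5. (success sensitiveness) $S\Downarrow$ if and only if $[\![S]\!]\Downarrow$. It is a *(concurrent) homomorphism* if moreover $[\![P_1|P_2]\!]=[\![P_1]\!]\,|\,[\![P_2]\!]$. **Theorem.** There is a homomorphism from the $\pi$-calculus into CPC. More precisely, there are an injective map $f:\mathcal N\to\mathcal N$ and a name $n\notin f(\mathcal N)$, and for every such pair $(f,n)$ the translation that maps $$[\![a(b).P]\!]=f(a)\bullet\lambda f(b)\bullet n\to[\![P]\!],\qquad[\![\bar a\langle b\rangle.P]\!]=f(a)\bullet f(b)\bullet\lambda n\to[\![P]\!],$$ $[\![(\nu a)P]\!]=(\nu f(a))[\![P]\!]$, $[\![0]\!]=0$, $[\![\surd]\!]=\surd$, $[\![{!P}]\!]={![\![P]\!]}$ and $[\![P|Q]\!]=[\![P]\!]\,|\,[\![Q]\!]$, together with the renaming policy $a\mapsto f(a)$ ($k=1$), is a homomorphism. -/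

import Mathlib

universe u

/-- A choice, for each finite set `A` of names, of an injective map all of whose values avoid `A`.
It is used to rename bound names to fresh ones. -/
theorem exists_freshen {N : Type u} [Infinite N] (A : Finset N) :
    ∃ f : N → N, Function.Injective f ∧ ∀ x, f x ∉ A := by
  have h : Cardinal.mk ((A : Set N)ᶜ : Set N) = Cardinal.mk N :=
    Cardinal.mk_compl_finset_of_infinite A
  obtain ⟨e⟩ := Cardinal.eq.1 h
  exact ⟨fun x => (e.symm x : N), fun x y hxy => e.symm.injective (Subtype.ext hxy),
    fun x hx => (e.symm x).2 hx⟩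

noncomputable def freshen {N : Type u} [Infinite N] (A : Finset N) : N → N :=
  Classical.choose (exists_freshen A)

theorem freshen_injective {N : Type u} [Infinite N] (A : Finset N) :
    Function.Injective (freshen A) :=
  (Classical.choose_spec (exists_freshen A)).1

theorem freshen_notMem {N : Type u} [Infinite N] (A : Finset N) (x : N) : freshen A x ∉ A :=
  (Classical.choose_spec (exists_freshen A)).2 x

/-- There is an infinite sequence of `r`-steps starting at `x`. -/
def Diverges {α : Type u} (r : α → α → Prop) (x : α) : Prop :=
  ∃ f : ℕ → α, f 0 = x ∧ ∀ i, r (f i) (f (i + 1))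

/-! ## The pi-calculus -/

namespace PiCalc

/-- Processes: `0`, `P | Q`, `!P`, `(ν a) P`, input `a(b).P`, output `a⟨b⟩.P`, success. -/
inductive Proc (N : Type u) : Type u
  | nil : Proc N
  | par (P Q : Proc N) : Proc N
  | rep (P : Proc N) : Proc N
  | res (a : N) (P : Proc N) : Proc N
  | inp (a b : N) (P : Proc N) : Proc N
  | out (a b : N) (P : Proc N) : Proc N
  | ok : Proc N

namespace Proc

/-- Free names. -/
def fn {N : Type u} [DecidableEq N] : Proc N → Finset N
  | nil => ∅
  | par P Q => P.fn ∪ Q.fn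
  | rep P => P.fn
  | res a P => P.fn.erase a
  | inp a b P => insert a (P.fn.erase b)
  | out a b P => insert a (insert b P.fn)
  | ok => ∅

/-- The action of a permutation of names on all names of a process, bound ones included. -/
def perm {N : Type u} (π : Equiv.Perm N) : Proc N → Proc N
  | nil => nil
  | par P Q => par (P.perm π) (Q.perm π)
  | rep P => rep (P.perm π)
  | res a P => res (π a) (P.perm π)
  | inp a b P => inp (π a) (π b) (P.perm π)
  | out a b P => out (π a) (π b) (P.perm π)
  | ok => ok

/-- Capture-avoiding simultaneous substitution of names for free names. A substitution is given
by a total function, which is the identity outside of its domain. Each bound name is renamed to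
a name that is fresh for everything that is substituted below it. -/
noncomputable def subst {N : Type u} [DecidableEq N] [Infinite N] : (N → N) → Proc N → Proc N
  | _, nil => nil
  | σ, par P Q => par (P.subst σ) (Q.subst σ)
  | σ, rep P => rep (P.subst σ)
  | σ, res a P =>
      let a' := freshen ((P.fn.erase a).image σ) a
      res a' (P.subst (Function.update σ a a'))
  | σ, inp a b P =>
      let b' := freshen ((P.fn.erase b).image σ) b
      inp (σ a) b' (P.subst (Function.update σ b b'))
  | σ, out a b P => out (σ a) (σ b) (P.subst σ)
  | _, ok => ok

/-- Alpha-equivalence: the congruence generated by exchanging a bound name with a name that is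
not free in its scope. -/
inductive Alpha {N : Type u} [DecidableEq N] : Proc N → Proc N → Prop
  | refl (P : Proc N) : Alpha P P
  | symm {P Q : Proc N} : Alpha P Q → Alpha Q P
  | trans {P Q R : Proc N} : Alpha P Q → Alpha Q R → Alpha P R
  | par {P P' Q Q' : Proc N} : Alpha P P' → Alpha Q Q' → Alpha (par P Q) (par P' Q')
  | rep {P P' : Proc N} : Alpha P P' → Alpha (rep P) (rep P')
  | res (a : N) {P P' : Proc N} : Alpha P P' → Alpha (res a P) (res a P')
  | inp (a b : N) {P P' : Proc N} : Alpha P P' → Alpha (inp a b P) (inp a b P')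
  | out (a b : N) {P P' : Proc N} : Alpha P P' → Alpha (out a b P) (out a b P')
  | rename_res (a c : N) (P : Proc N) : c ∉ P.fn →
      Alpha (res a P) (res c (P.perm (Equiv.swap a c)))
  | rename_inp (a b c : N) (P : Proc N) : c ∉ P.fn →
      Alpha (inp a b P) (inp a c (P.perm (Equiv.swap b c)))

/-- Structural equivalence (processes being taken up to alpha-equivalence). -/
inductive SEquiv {N : Type u} [DecidableEq N] : Proc N → Proc N → Prop
  | alpha {P Q : Proc N} : Alpha P Q → SEquiv P Q
  | symm {P Q : Proc N} : SEquiv P Q → SEquiv Q P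
  | trans {P Q R : Proc N} : SEquiv P Q → SEquiv Q R → SEquiv P R
  | par {P P' Q Q' : Proc N} : SEquiv P P' → SEquiv Q Q' → SEquiv (par P Q) (par P' Q')
  | rep {P P' : Proc N} : SEquiv P P' → SEquiv (rep P) (rep P')
  | res (a : N) {P P' : Proc N} : SEquiv P P' → SEquiv (res a P) (res a P')
  | inp (a b : N) {P P' : Proc N} : SEquiv P P' → SEquiv (inp a b P) (inp a b P')
  | out (a b : N) {P P' : Proc N} : SEquiv P P' → SEquiv (out a b P) (out a b P')
  | par_nil (P : Proc N) : SEquiv (Proc.par P nil) P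
  | par_comm (P Q : Proc N) : SEquiv (Proc.par P Q) (Proc.par Q P)
  | par_assoc (P Q R : Proc N) :
      SEquiv (Proc.par P (Proc.par Q R)) (Proc.par (Proc.par P Q) R)
  | rep_unfold (P : Proc N) : SEquiv (Proc.rep P) (Proc.par P (Proc.rep P))
  | res_nil (a : N) : SEquiv (Proc.res a nil) nil
  | res_comm (a b : N) (P : Proc N) :
      SEquiv (Proc.res a (Proc.res b P)) (Proc.res b (Proc.res a P))
  | extrude (a : N) (P Q : Proc N) : a ∉ P.fn →
      SEquiv (Proc.par P (Proc.res a Q)) (Proc.res a (Proc.par P Q))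

/-- Reduction. -/
inductive Red {N : Type u} [DecidableEq N] [Infinite N] : Proc N → Proc N → Prop
  | comm (a b c : N) (P Q : Proc N) :
      Red (Proc.par (inp a b P) (out a c Q)) (Proc.par (P.subst (Function.update id b c)) Q)
  | par {P P' : Proc N} (Q : Proc N) : Red P P' → Red (Proc.par P Q) (Proc.par P' Q)
  | res (a : N) {P P' : Proc N} : Red P P' → Red (Proc.res a P) (Proc.res a P')
  | struct {P Q Q' P' : Proc N} : SEquiv P Q → Red Q Q' → SEquiv Q' P' → Red P P'

/-- The reflexive transitive closure of reduction. -/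
def Reds {N : Type u} [DecidableEq N] [Infinite N] : Proc N → Proc N → Prop :=
  Relation.ReflTransGen Red

/-- The process can reduce to one with a top-level success component. -/
def Succeeds {N : Type u} [DecidableEq N] [Infinite N] (P : Proc N) : Prop :=
  ∃ P' P'', Reds P P' ∧ SEquiv P' (par P'' ok)

end Proc

/-- The operators of the pi-calculus, indexed by arity. -/
inductive Op (N : Type u) : ℕ → Type u
  | nil : Op N 0
  | ok : Op N 0
  | par : Op N 2
  | rep : Op N 1
  | res (a : N) : Op N 1
  | inp (a b : N) : Op N 1
  | out (a b : N) : Op N 1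

/-- Application of an operator to its arguments. -/
def Op.app {N : Type u} : {k : ℕ} → Op N k → (Fin k → Proc N) → Proc N
  | _, .nil, _ => .nil
  | _, .ok, _ => .ok
  | _, .par, S => .par (S 0) (S 1)
  | _, .rep, S => .rep (S 0)
  | _, .res a, S => .res a (S 0)
  | _, .inp a b, S => .inp a b (S 0)
  | _, .out a b, S => .out a b (S 0)

end PiCalc

/-! ## Concurrent pattern calculus -/

namespace CPC

/-- Patterns: binding names `λ x`, variable names `x`, protected names `⌜x⌝`, and compounds. That
the binding names be pairwise distinct is required where patterns enter processes. -/
inductive Pattern (N : Type u) : Type u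
  | bind (x : N) : Pattern N
  | var (x : N) : Pattern N
  | prot (x : N) : Pattern N
  | comp (p q : Pattern N) : Pattern N

/-- Communicable patterns: those without binding and protected names. -/
inductive Comm (N : Type u) : Type u
  | var (x : N) : Comm N
  | comp (c d : Comm N) : Comm N

namespace Comm

def names {N : Type u} [DecidableEq N] : Comm N → Finset N
  | var x => {x}
  | comp c d => c.names ∪ d.names

/-- A communicable pattern as a pattern. -/
def toPattern {N : Type u} : Comm N → Pattern N
  | var x => .var x
  | comp c d => .comp c.toPattern d.toPattern

/-- Protection, extended to communicable patterns. -/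
def protect {N : Type u} : Comm N → Pattern N
  | var x => .prot x
  | comp c d => .comp c.protect d.protect

end Comm

namespace Pattern

/-- The pattern as a communicable pattern, if it is one. -/
def toComm? {N : Type u} : Pattern N → Option (Comm N)
  | bind _ => none
  | var x => some (.var x)
  | prot _ => none
  | comp p q => do
      let c ← p.toComm?
      let d ← q.toComm?
      return .comp c d

/-- Binding names, in order and with repetitions. -/
def bn {N : Type u} : Pattern N → List N
  | bind x => [x]
  | var _ => []
  | prot _ => []
  | comp p q => p.bn ++ q.bn

/-- Variable names. -/
def vn {N : Type u} [DecidableEq N] : Pattern N → Finset N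
  | bind _ => ∅
  | var x => {x}
  | prot _ => ∅
  | comp p q => p.vn ∪ q.vn

/-- Protected names. -/
def pn {N : Type u} [DecidableEq N] : Pattern N → Finset N
  | bind _ => ∅
  | var _ => ∅
  | prot x => {x}
  | comp p q => p.pn ∪ q.pn

/-- Free names. -/
def fn {N : Type u} [DecidableEq N] (p : Pattern N) : Finset N := p.vn ∪ p.pn

/-- Simultaneously substitute `σ` for the free names and rename the binding names by `f`. -/
def act {N : Type u} (σ : N → Comm N) (f : N → N) : Pattern N → Pattern N
  | bind x => bind (f x)
  | var x => (σ x).toPattern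
  | prot x => (σ x).protect
  | comp p q => comp (p.act σ f) (q.act σ f)

theorem bn_toPattern {N : Type u} (c : Comm N) : c.toPattern.bn = [] := by
  induction c with
  | var x => rfl
  | comp c d hc hd => simp [Comm.toPattern, bn, hc, hd]

theorem bn_protect {N : Type u} (c : Comm N) : c.protect.bn = [] := by
  induction c with
  | var x => rfl
  | comp c d hc hd => simp [Comm.protect, bn, hc, hd]

theorem bn_act {N : Type u} (σ : N → Comm N) (f : N → N) (p : Pattern N) :
    (p.act σ f).bn = p.bn.map f := by
  induction p with
  | bind x => rfl
  | var x => simp [act, bn, bn_toPattern]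
  | prot x => simp [act, bn, bn_protect]
  | comp p q hp hq => simp [act, bn, hp, hq]

theorem nodup_bn_act {N : Type u} (σ : N → Comm N) {f : N → N} (hf : Function.Injective f)
    {p : Pattern N} (hp : p.bn.Nodup) : (p.act σ f).bn.Nodup := by
  rw [bn_act]
  exact hp.map hf

end Pattern

/-- Partial functions from names to communicable patterns. -/
abbrev PSubst (N : Type u) : Type u := N → Option (Comm N)

namespace PSubst

def empty {N : Type u} : PSubst N := fun _ => none

def single {N : Type u} [DecidableEq N] (x : N) (c : Comm N) : PSubst N :=
  fun y => if y = x then some c else none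

/-- Union; it is only used for partial functions with disjoint domains. -/
def union {N : Type u} (σ ρ : PSubst N) : PSubst N := fun x => (σ x).orElse fun _ => ρ x

/-- The total function that is the identity outside of the domain. -/
def total {N : Type u} (σ : PSubst N) : N → Comm N := fun x => (σ x).getD (.var x)

end PSubst

/-- Unification of two patterns. -/
def unify {N : Type u} [DecidableEq N] : Pattern N → Pattern N → Option (PSubst N × PSubst N)
  | .bind x, q => q.toComm?.map fun c => (PSubst.single x c, PSubst.empty)
  | p, .bind x => p.toComm?.map fun c => (PSubst.empty, PSubst.single x c)
  | .var x, .var y => if x = y then some (PSubst.empty, PSubst.empty) else none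
  | .var x, .prot y => if x = y then some (PSubst.empty, PSubst.empty) else none
  | .prot x, .var y => if x = y then some (PSubst.empty, PSubst.empty) else none
  | .prot x, .prot y => if x = y then some (PSubst.empty, PSubst.empty) else none
  | .comp p₁ p₂, .comp q₁ q₂ => do
      let s₁ ← unify p₁ q₁
      let s₂ ← unify p₂ q₂
      return (s₁.1.union s₂.1, s₁.2.union s₂.2)
  | _, _ => none

/-- Processes: `0`, `P | Q`, `!P`, `(ν a) P`, the case `p → P`, where the binding names of `p`
are pairwise distinct and bind in `P`, and success. -/
inductive Proc (N : Type u) : Type u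
  | nil : Proc N
  | par (P Q : Proc N) : Proc N
  | rep (P : Proc N) : Proc N
  | res (a : N) (P : Proc N) : Proc N
  | case (p : Pattern N) (hp : p.bn.Nodup) (P : Proc N) : Proc N
  | ok : Proc N

namespace Proc

/-- Free names. -/
def fn {N : Type u} [DecidableEq N] : Proc N → Finset N
  | nil => ∅
  | par P Q => P.fn ∪ Q.fn
  | rep P => P.fn
  | res a P => P.fn.erase a
  | case p _ P => p.fn ∪ (P.fn \ p.bn.toFinset)
  | ok => ∅

/-- The action of a permutation of names on all names of a process, bound ones included. -/
def perm {N : Type u} (π : Equiv.Perm N) : Proc N → Proc N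
  | nil => nil
  | par P Q => par (P.perm π) (Q.perm π)
  | rep P => rep (P.perm π)
  | res a P => res (π a) (P.perm π)
  | case p hp P =>
      case (p.act (fun x => .var (π x)) π) (Pattern.nodup_bn_act _ π.injective hp) (P.perm π)
  | ok => ok

/-- Capture-avoiding simultaneous substitution of communicable patterns for free names. A
substitution is given by a total function, which is the identity outside of its domain. Bound
names are renamed to names that are fresh for everything that is substituted below them. -/
noncomputable def subst {N : Type u} [DecidableEq N] [Infinite N] :
    (N → Comm N) → Proc N → Proc N
  | _, nil => nil
  | σ, par P Q => par (P.subst σ) (Q.subst σ)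
  | σ, rep P => rep (P.subst σ)
  | σ, res a P =>
      let a' := freshen ((P.fn.erase a).biUnion fun x => (σ x).names) a
      res a' (P.subst (Function.update σ a (.var a')))
  | σ, case p hp P =>
      let A := (P.fn \ p.bn.toFinset).biUnion fun x => (σ x).names
      case (p.act σ (freshen A)) (Pattern.nodup_bn_act σ (freshen_injective A) hp)
        (P.subst fun x => if x ∈ p.bn then .var (freshen A x) else σ x)
  | _, ok => ok

/-- Alpha-equivalence: the congruence generated by renaming the bound names of a restriction or
of a case by a permutation that fixes the other free names of the scope. -/
inductive Alpha {N : Type u} [DecidableEq N] : Proc N → Proc N → Prop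
  | refl (P : Proc N) : Alpha P P
  | symm {P Q : Proc N} : Alpha P Q → Alpha Q P
  | trans {P Q R : Proc N} : Alpha P Q → Alpha Q R → Alpha P R
  | par {P P' Q Q' : Proc N} : Alpha P P' → Alpha Q Q' → Alpha (par P Q) (par P' Q')
  | rep {P P' : Proc N} : Alpha P P' → Alpha (rep P) (rep P')
  | res (a : N) {P P' : Proc N} : Alpha P P' → Alpha (res a P) (res a P')
  | case (p : Pattern N) (hp : p.bn.Nodup) {P P' : Proc N} :
      Alpha P P' → Alpha (case p hp P) (case p hp P')
  | rename_res (a c : N) (P : Proc N) : c ∉ P.fn →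
      Alpha (res a P) (res c (P.perm (Equiv.swap a c)))
  | rename_case (p : Pattern N) (hp : p.bn.Nodup) (P : Proc N) (π : Equiv.Perm N) :
      (∀ x ∈ P.fn, x ∉ p.bn → π x = x) →
      Alpha (case p hp P)
        (case (p.act .var π) (Pattern.nodup_bn_act _ π.injective hp) (P.perm π))

/-- Structural equivalence (processes being taken up to alpha-equivalence). -/
inductive SEquiv {N : Type u} [DecidableEq N] : Proc N → Proc N → Prop
  | alpha {P Q : Proc N} : Alpha P Q → SEquiv P Q
  | symm {P Q : Proc N} : SEquiv P Q → SEquiv Q P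
  | trans {P Q R : Proc N} : SEquiv P Q → SEquiv Q R → SEquiv P R
  | par {P P' Q Q' : Proc N} : SEquiv P P' → SEquiv Q Q' → SEquiv (par P Q) (par P' Q')
  | rep {P P' : Proc N} : SEquiv P P' → SEquiv (rep P) (rep P')
  | res (a : N) {P P' : Proc N} : SEquiv P P' → SEquiv (res a P) (res a P')
  | case (p : Pattern N) (hp : p.bn.Nodup) {P P' : Proc N} :
      SEquiv P P' → SEquiv (case p hp P) (case p hp P')
  | par_nil (P : Proc N) : SEquiv (Proc.par P nil) P
  | par_comm (P Q : Proc N) : SEquiv (Proc.par P Q) (Proc.par Q P)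
  | par_assoc (P Q R : Proc N) :
      SEquiv (Proc.par P (Proc.par Q R)) (Proc.par (Proc.par P Q) R)
  | rep_unfold (P : Proc N) : SEquiv (Proc.rep P) (Proc.par P (Proc.rep P))
  | res_nil (a : N) : SEquiv (Proc.res a nil) nil
  | res_comm (a b : N) (P : Proc N) :
      SEquiv (Proc.res a (Proc.res b P)) (Proc.res b (Proc.res a P))
  | extrude (a : N) (P Q : Proc N) : a ∉ P.fn →
      SEquiv (Proc.par P (Proc.res a Q)) (Proc.res a (Proc.par P Q))

/-- Reduction. -/
inductive Red {N : Type u} [DecidableEq N] [Infinite N] : Proc N → Proc N → Prop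
  | comm (p q : Pattern N) (hp : p.bn.Nodup) (hq : q.bn.Nodup) (P Q : Proc N)
      (σ ρ : PSubst N) : unify p q = some (σ, ρ) →
      Red (Proc.par (case p hp P) (case q hq Q)) (Proc.par (P.subst σ.total) (Q.subst ρ.total))
  | par {P P' : Proc N} (Q : Proc N) : Red P P' → Red (Proc.par P Q) (Proc.par P' Q)
  | res (a : N) {P P' : Proc N} : Red P P' → Red (Proc.res a P) (Proc.res a P')
  | struct {P Q Q' P' : Proc N} : SEquiv P Q → Red Q Q' → SEquiv Q' P' → Red P P'

/-- The reflexive transitive closure of reduction. -/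
def Reds {N : Type u} [DecidableEq N] [Infinite N] : Proc N → Proc N → Prop :=
  Relation.ReflTransGen Red

/-- The process has a top-level success component. -/
def HasOk {N : Type u} [DecidableEq N] (P : Proc N) : Prop :=
  ∃ P', SEquiv P (par P' ok)

/-- The process can reduce to one with a top-level success component. -/
def Succeeds {N : Type u} [DecidableEq N] [Infinite N] (P : Proc N) : Prop :=
  ∃ P', Reds P P' ∧ HasOk P'

/-- Restriction of several names. -/
def resList {N : Type u} (l : List N) (P : Proc N) : Proc N := l.foldr res P

/-- The barb `m`: up to structural equivalence, the process is
`(ν l) (p → P' | P'')`, where no protected name of `p` is restricted, and `m` is the set of the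
free names of `p` that are not restricted. -/
def Barb {N : Type u} [DecidableEq N] (P : Proc N) (m : Finset N) : Prop :=
  ∃ (l : List N) (p : Pattern N) (hp : p.bn.Nodup) (P' P'' : Proc N),
    SEquiv P (resList l (par (case p hp P') P'')) ∧
      Disjoint p.pn l.toFinset ∧ m = p.fn \ l.toFinset

end Proc

/-- Process terms with holes indexed by `Fin k`. -/
inductive Ctx (N : Type u) (k : ℕ) : Type u
  | hole (i : Fin k) : Ctx N k
  | nil : Ctx N k
  | par (C D : Ctx N k) : Ctx N k
  | rep (C : Ctx N k) : Ctx N k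
  | res (a : N) (C : Ctx N k) : Ctx N k
  | case (p : Pattern N) (hp : p.bn.Nodup) (C : Ctx N k) : Ctx N k
  | ok : Ctx N k

namespace Ctx

/-- The number of occurrences of a hole. -/
def count {N : Type u} {k : ℕ} (i : Fin k) : Ctx N k → ℕ
  | hole j => if j = i then 1 else 0
  | nil => 0
  | par C D => C.count i + D.count i
  | rep C => C.count i
  | res _ C => C.count i
  | case _ _ C => C.count i
  | ok => 0

/-- `C` is a `k`-ary context: each of its `k` holes appears exactly once. -/
def IsContext {N : Type u} {k : ℕ} (C : Ctx N k) : Prop := ∀ i, C.count i = 1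

/-- Filling of the holes; names that are free in the arguments may be captured. -/
def fill {N : Type u} {k : ℕ} (P : Fin k → Proc N) : Ctx N k → Proc N
  | hole i => P i
  | nil => .nil
  | par C D => .par (C.fill P) (D.fill P)
  | rep C => .rep (C.fill P)
  | res a C => .res a (C.fill P)
  | case p hp C => .case p hp (C.fill P)
  | ok => .ok

end Ctx

/-- A symmetric relation that preserves barbs and success, is closed under (strong) reduction, and
is closed under all contexts. -/
structure IsBarbedRel {N : Type u} [DecidableEq N] [Infinite N]
    (R : Proc N → Proc N → Prop) : Prop where
  symm : ∀ P Q, R P Q → R Q P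
  barb : ∀ P Q, R P Q → ∀ m, P.Barb m → Q.Barb m
  ok : ∀ P Q, R P Q → P.HasOk → Q.HasOk
  red : ∀ P Q, R P Q → ∀ P', P.Red P' → ∃ Q', Q.Red Q' ∧ R P' Q'
  ctx : ∀ P Q, R P Q → ∀ C : Ctx N 1, C.IsContext → R (C.fill fun _ => P) (C.fill fun _ => Q)

/-- The behavioural equivalence of CPC: (strong) barbed congruence, the largest relation as
above. -/
def BEquiv {N : Type u} [DecidableEq N] [Infinite N] (P Q : Proc N) : Prop :=
  ∃ R : Proc N → Proc N → Prop, IsBarbedRel R ∧ R P Q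

end CPC

/-! ## Encodings of the pi-calculus into CPC -/

/-- `τ` is the substitution on target names that corresponds under the renaming policy `φ` to the
substitution `σ` on source names: it maps the tuple `φ a` to the tuple `φ (σ a)` and leaves all
names outside of these tuples unchanged. -/
def IsInducedSubst {N : Type u} {k : ℕ} (φ : N → Fin k → N) (σ τ : N → N) : Prop :=
  (∀ a i, τ (φ a i) = φ (σ a) i) ∧ ∀ m, (∀ a i, m ≠ φ a i) → τ m = m

/-- Valid encodings of the pi-calculus into CPC, with renaming policy `φ`. Terms of both calculi
are understood up to alpha-equivalence. -/
structure IsValidEncoding {N : Type u} [DecidableEq N] [Infinite N]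
    (tr : PiCalc.Proc N → CPC.Proc N) {k : ℕ} (φ : N → Fin k → N) : Prop where
  k_pos : 0 < k
  /-- The translation is well defined on terms up to alpha-equivalence. -/
  alpha : ∀ S S' : PiCalc.Proc N, S.Alpha S' → (tr S).Alpha (tr S')
  compositional : ∀ {j : ℕ} (op : PiCalc.Op N j) (M : Finset N),
    ∃ C : CPC.Ctx N j, C.IsContext ∧
      ∀ S : Fin j → PiCalc.Proc N, (Finset.univ.biUnion fun i => (S i).fn) = M →
        tr (op.app S) = C.fill fun i => tr (S i)
  name_invariant : ∀ σ : N → N, {a | σ a ≠ a}.Finite →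
    ∃ τ : N → N, {m | τ m ≠ m}.Finite ∧ IsInducedSubst φ σ τ ∧
      ∀ S : PiCalc.Proc N,
        (Function.Injective σ → (tr (S.subst σ)).Alpha ((tr S).subst fun m => .var (τ m))) ∧
        (¬ Function.Injective σ →
          CPC.BEquiv (tr (S.subst σ)) ((tr S).subst fun m => .var (τ m)))
  complete : ∀ S S' : PiCalc.Proc N, S.Reds S' →
    ∃ T, (tr S).Reds T ∧ CPC.BEquiv T (tr S')
  sound : ∀ (S : PiCalc.Proc N) (T : CPC.Proc N), (tr S).Reds T →
    ∃ S', S.Reds S' ∧ ∃ T', T.Reds T' ∧ CPC.BEquiv T' (tr S')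
  divergence : ∀ S : PiCalc.Proc N, Diverges CPC.Proc.Red (tr S) → Diverges PiCalc.Proc.Red S
  success : ∀ S : PiCalc.Proc N, S.Succeeds ↔ (tr S).Succeeds

/-- Concurrent homomorphisms: valid encodings that preserve parallel composition. -/
structure IsConcurrentHom {N : Type u} [DecidableEq N] [Infinite N]
    (tr : PiCalc.Proc N → CPC.Proc N) {k : ℕ} (φ : N → Fin k → N) : Prop where
  valid : IsValidEncoding tr φ
  par : ∀ P Q : PiCalc.Proc N, tr (.par P Q) = .par (tr P) (tr Q)

/-- The pattern `a • λ b • n` (compounds associate to the left). -/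
def inputPattern {N : Type u} (a b n : N) : CPC.Pattern N :=
  .comp (.comp (.var a) (.bind b)) (.var n)

/-- The pattern `a • b • λ n`. -/
def outputPattern {N : Type u} (a b n : N) : CPC.Pattern N :=
  .comp (.comp (.var a) (.var b)) (.bind n)

theorem inputPattern_nodup {N : Type u} (a b n : N) : (inputPattern a b n).bn.Nodup := by
  simp [inputPattern, CPC.Pattern.bn]

theorem outputPattern_nodup {N : Type u} (a b n : N) : (outputPattern a b n).bn.Nodup := by
  simp [outputPattern, CPC.Pattern.bn]

/-- The translation: `f` gives the target name that represents a source name, and `n` is the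
reserved name. -/
def piToCPC {N : Type u} (f : N → N) (n : N) : PiCalc.Proc N → CPC.Proc N
  | .nil => .nil
  | .par P Q => .par (piToCPC f n P) (piToCPC f n Q)
  | .rep P => .rep (piToCPC f n P)
  | .res a P => .res (f a) (piToCPC f n P)
  | .inp a b P => .case (inputPattern (f a) (f b) n) (inputPattern_nodup _ _ _) (piToCPC f n P)
  | .out a b P => .case (outputPattern (f a) (f b) n) (outputPattern_nodup _ _ _) (piToCPC f n P)
  | .ok => .ok

/-! The patterns `f a • λ (f b) • n` and `f a • f c • λ n` unify, sending `f b` to `f c` and `n` to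
`n`. Hence one π-reduction becomes one CPC reduction, and the continuation of the output is
unchanged (`PiCalc.Proc.Red.piToCPC`).

The converse needs care, because alpha-conversion and `≡` leave the image of the translation: bound
names may move outside the range of `f`, and `λ n` may become `λ z`, with `z` replacing `n` in the
continuation. Two notions handle this. `Sorted c` is a sort discipline that separates the names in
last positions from channels and data; `decode` erases the last components. Sortedness is invariant
under `≡` and preserved by reduction, and on sorted processes `decode` carries `≡` to `≡` and a
reduction to a reduction (`SEquiv.sorted_decode`, `Red.sorted_decode`). Two inputs never unify, and
neither do two outputs, so no other communication can arise.

A translation is sorted for `{n}`, and its decoding is the source process with all names renamed by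
a permutation that extends `f` on them (`decode_piToCPC`). Conversely, a process sorted for `{n}`
whose decoding has its free names in the range of `f` is alpha-equivalent to a translation
(`exists_alpha_piToCPC_perm`). So every reduct of a translation is alpha-equivalent to the
translation of a reduct (`exists_red_of_red_piToCPC`). The correspondence is therefore step by step,
which gives soundness and divergence reflection; success is pulled back by decoding. Barbed
congruence is only ever needed between structurally equivalent processes, and `≡` is itself a barbed
congruence. -/

/-! ### Permutations with prescribed values. -/

/-- A partial bijection between finite sets of names that is the identity on `X` extends to a
permutation. -/
theorem exists_perm_extending {N : Type u} [DecidableEq N] (B X : Finset N) (u v : N → N)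
    (hu : Set.InjOn u B) (hv : Set.InjOn v B) (huX : ∀ b ∈ B, u b ∉ X) (hvX : ∀ b ∈ B, v b ∉ X) :
    ∃ κ : Equiv.Perm N, (∀ b ∈ B, κ (u b) = v b) ∧ ∀ x ∈ X, κ x = x := by
  induction B using Finset.induction_on with
  | empty => exact ⟨1, by simp, by simp⟩
  | insert b B hb ih =>
    have hsub : (B : Set N) ⊆ (insert b B : Finset N) := by simp
    obtain ⟨κ, h1, h2⟩ := ih (hu.mono hsub) (hv.mono hsub)
      (fun x hx => huX x (Finset.mem_insert_of_mem hx))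
      (fun x hx => hvX x (Finset.mem_insert_of_mem hx))
    -- The transposition corrects the value at `u b`. It moves neither the values already prescribed
    -- nor `X`, since `κ (u b)` and `v b` differ from all of these.
    refine ⟨Equiv.swap (κ (u b)) (v b) * κ, ?_, ?_⟩
    · intro x hx
      rcases Finset.mem_insert.1 hx with rfl | hx'
      · simp
      · have hne : x ≠ b := fun h => hb (h ▸ hx')
        rw [Equiv.Perm.mul_apply, h1 x hx', Equiv.swap_apply_of_ne_of_ne]
        · rw [← h1 x hx']
          exact fun h => hne (hu (by simp [hx']) (by simp) (κ.injective h))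
        · exact fun h => hne (hv (by simp [hx']) (by simp) h)
    · intro x hx
      rw [Equiv.Perm.mul_apply, h2 x hx, Equiv.swap_apply_of_ne_of_ne]
      · intro h
        rw [← h2 x hx] at h
        exact huX b (by simp) (κ.injective h ▸ hx)
      · exact fun h => hvX b (by simp) (h ▸ hx)

theorem Function.Injective.exists_perm_eqOn {N : Type u} [DecidableEq N] {f : N → N}
    (hf : Function.Injective f) (B : Finset N) : ∃ κ : Equiv.Perm N, ∀ b ∈ B, κ b = f b := by
  obtain ⟨κ, h, -⟩ := exists_perm_extending B ∅ id f (Set.injOn_id _) hf.injOn (by simp) (by simp)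
  exact ⟨κ, h⟩

/-- Moving one point of a permutation. -/
theorem swap_mul_eqOn {N : Type u} [DecidableEq N] {s s' : N → N} {π : Equiv.Perm N}
    {A : Finset N} {x b c : N} (hb : ∀ y ∈ A.erase x, b ≠ π (s y))
    (hc : ∀ y ∈ A.erase x, c ≠ s' y) (h : ∀ y ∈ A.erase x, s' y = π (s y)) (hx : π (s x) = b)
    (hx' : s' x = c) : ∀ y ∈ A, s' y = (Equiv.swap b c * π) (s y) := by
  intro y hy
  by_cases hyx : y = x
  · subst hyx
    simp [hx, hx']
  · have hy' : y ∈ A.erase x := by simp [hy, hyx]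
    rw [Equiv.Perm.mul_apply, Equiv.swap_apply_of_ne_of_ne (hb y hy').symm, h y hy']
    exact fun e => hc y hy' (by rw [h y hy', e])

/-! ### The π-calculus: permutations, alpha-equivalence and substitution. -/

namespace PiCalc.Proc

variable {N : Type u} [DecidableEq N]

omit [DecidableEq N] in
theorem perm_perm (P : Proc N) (π ρ : Equiv.Perm N) : (P.perm π).perm ρ = P.perm (ρ * π) := by
  induction P <;> simp_all [perm]

omit [DecidableEq N] in
theorem perm_one (P : Proc N) : P.perm 1 = P := by
  induction P <;> simp_all [perm]

theorem fn_perm (P : Proc N) (π : Equiv.Perm N) : (P.perm π).fn = P.fn.image π := by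
  induction P <;> simp_all [perm, fn, Finset.image_union, Finset.image_erase π.injective,
    Finset.image_insert]

theorem Alpha.perm {P Q : Proc N} (h : Alpha P Q) (π : Equiv.Perm N) :
    Alpha (P.perm π) (Q.perm π) := by
  induction h with
  | refl P => exact .refl _
  | symm _ ih => exact ih.symm
  | trans _ _ ih₁ ih₂ => exact ih₁.trans ih₂
  | par _ _ ih₁ ih₂ => exact .par ih₁ ih₂
  | rep _ ih => exact .rep ih
  | res a _ ih => exact .res _ ih
  | inp a b _ ih => exact .inp _ _ ih
  | out a b _ ih => exact .out _ _ ih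
  | rename_res a c P hc =>
    have := Alpha.rename_res (π a) (π c) (P.perm π) (by simpa [fn_perm] using hc)
    -- Conjugation by `π` turns the transposition of `a`, `c` into that of `π a`, `π c`.
    rwa [perm_perm, Equiv.swap_apply_apply, inv_mul_cancel_right, ← perm_perm] at this
  | rename_inp a b c P hc =>
    have := Alpha.rename_inp (π a) (π b) (π c) (P.perm π) (by simpa [fn_perm] using hc)
    rwa [perm_perm, Equiv.swap_apply_apply, inv_mul_cancel_right, ← perm_perm] at this

theorem image_swap_erase {A : Finset N} {a c : N} (hc : c ∉ A) :
    (A.image (Equiv.swap a c)).erase c = A.erase a := by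
  ext x
  simp only [Finset.mem_erase, Finset.mem_image]
  constructor
  · rintro ⟨hx, y, hy, rfl⟩
    have h1 : y ≠ a := by rintro rfl; simp at hx
    have h2 : y ≠ c := by rintro rfl; exact hc hy
    rw [Equiv.swap_apply_of_ne_of_ne h1 h2]
    exact ⟨h1, hy⟩
  · rintro ⟨hx, hy⟩
    have h2 : x ≠ c := by rintro rfl; exact hc hy
    exact ⟨h2, x, hy, Equiv.swap_apply_of_ne_of_ne hx h2⟩

theorem Alpha.fn_eq {P Q : Proc N} (h : Alpha P Q) : P.fn = Q.fn := by
  induction h <;> simp_all [fn, fn_perm, image_swap_erase]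

theorem SEquiv.refl (P : Proc N) : SEquiv P P := .alpha (.refl P)

theorem SEquiv.fn_eq {P Q : Proc N} (h : SEquiv P Q) : P.fn = Q.fn := by
  induction h with
  | alpha h => exact h.fn_eq
  | par_comm => simp [fn, Finset.union_comm]
  | par_assoc => simp [fn]
  | res_comm => simp [fn, Finset.erase_right_comm]
  | extrude a P Q ha => simp [fn, Finset.erase_union_distrib, Finset.erase_eq_of_notMem ha]
  | _ => simp_all [fn]

theorem SEquiv.perm {P Q : Proc N} (h : SEquiv P Q) (π : Equiv.Perm N) :
    SEquiv (P.perm π) (Q.perm π) := by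
  induction h with
  | alpha h => exact .alpha (h.perm π)
  | symm _ ih => exact ih.symm
  | trans _ _ ih₁ ih₂ => exact ih₁.trans ih₂
  | par _ _ ih₁ ih₂ => exact .par ih₁ ih₂
  | rep _ ih => exact .rep ih
  | res a _ ih => exact .res _ ih
  | inp a b _ ih => exact .inp _ _ ih
  | out a b _ ih => exact .out _ _ ih
  | par_nil => exact .par_nil _
  | par_comm => exact .par_comm _ _
  | par_assoc => exact .par_assoc _ _ _
  | rep_unfold => exact .rep_unfold _
  | res_nil => exact .res_nil _
  | res_comm => exact .res_comm _ _ _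
  | extrude a P Q ha => exact .extrude _ _ _ (by simpa [fn_perm] using ha)

/-- The form in which binders are matched below: it also covers `c = a`, so no case distinction is
needed when two independently chosen bound names happen to coincide. -/
theorem Alpha.res_rebind {a c : N} {P Q : Proc N} (hc : c ∉ P.fn.erase a)
    (h : Alpha (P.perm (Equiv.swap a c)) Q) : Alpha (Proc.res a P) (Proc.res c Q) := by
  by_cases hac : c = a
  · subst hac
    rw [Equiv.swap_self] at h
    exact .res _ (by simpa using (perm_one P) ▸ h)
  · exact (Alpha.rename_res a c P (by simpa [hac] using hc)).trans (.res _ h)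

theorem Alpha.inp_rebind {a b c : N} {P Q : Proc N} (hc : c ∉ P.fn.erase b)
    (h : Alpha (P.perm (Equiv.swap b c)) Q) : Alpha (Proc.inp a b P) (Proc.inp a c Q) := by
  by_cases hac : c = b
  · subst hac
    rw [Equiv.swap_self] at h
    exact .inp _ _ (by simpa using (perm_one P) ▸ h)
  · exact (Alpha.rename_inp a b c P (by simpa [hac] using hc)).trans (.inp _ _ h)

/-- Permutations that agree on the free names have alpha-equivalent actions. -/
theorem alpha_perm_of_eqOn {P : Proc N} {π ρ : Equiv.Perm N} (h : ∀ x ∈ P.fn, ρ x = π x) :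
    Alpha (P.perm π) (P.perm ρ) := by
  induction P generalizing π ρ with
  | nil => exact .refl _
  | par P Q ihP ihQ =>
    exact .par (ihP fun x hx => h x (by simp [fn, hx])) (ihQ fun x hx => h x (by simp [fn, hx]))
  | rep P ih => exact .rep (ih h)
  | ok => exact .refl _
  | out a b P ih =>
    simp only [perm, ← h a (by simp [fn]), ← h b (by simp [fn])]
    exact .out _ _ (ih fun x hx => h x (by simp [fn, hx]))
  | res a P ih =>
    simp only [perm]
    have h' : ∀ x ∈ P.fn.erase a, ρ x = π x := h
    refine .res_rebind ?_ ?_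
    · rw [fn_perm, ← Finset.image_erase π.injective]
      simp only [Finset.mem_image, not_exists, not_and]
      intro x hx e
      rw [← h' x hx] at e
      simp [ρ.injective e] at hx
    -- Once the transposition of `π a` and `ρ a` is composed with `π`, the result agrees with `ρ` at
    -- `a` too, so the induction hypothesis applies to the whole scope.
    · rw [perm_perm]
      exact ih (swap_mul_eqOn (s := id) (s' := ρ)
        (fun y hy e => by simp [π.injective e] at hy)
        (fun y hy e => by simp [ρ.injective e] at hy) h' rfl rfl)
  | inp a b P ih =>
    simp only [perm, ← h a (by simp [fn])]
    have h' : ∀ x ∈ P.fn.erase b, ρ x = π x := fun x hx => h x (Finset.mem_insert_of_mem hx)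
    refine .inp_rebind ?_ ?_
    · rw [fn_perm, ← Finset.image_erase π.injective]
      simp only [Finset.mem_image, not_exists, not_and]
      intro x hx e
      rw [← h' x hx] at e
      simp [ρ.injective e] at hx
    · rw [perm_perm]
      exact ih (swap_mul_eqOn (s := id) (s' := ρ)
        (fun y hy e => by simp [π.injective e] at hy)
        (fun y hy e => by simp [ρ.injective e] at hy) h' rfl rfl)

theorem alpha_perm_of_fixed {P : Proc N} {π : Equiv.Perm N} (h : ∀ x ∈ P.fn, π x = x) :
    Alpha P (P.perm π) := by
  have := alpha_perm_of_eqOn (P := P) (π := 1) (ρ := π) (by simpa using h)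
  rwa [perm_one] at this

section Subst

variable [Infinite N]

/-- This hides `freshen`: all that is used of the new bound name is that it differs from the images
of the other free names of the scope. -/
theorem exists_subst_res (s : N → N) (a : N) (P : Proc N) :
    ∃ a', (∀ y ∈ P.fn.erase a, a' ≠ s y) ∧
      (res a P).subst s = res a' (P.subst (Function.update s a a')) :=
  ⟨_, fun _ hy e => freshen_notMem _ a (e ▸ Finset.mem_image_of_mem s hy), rfl⟩

theorem exists_subst_inp (s : N → N) (a b : N) (P : Proc N) :
    ∃ b', (∀ y ∈ P.fn.erase b, b' ≠ s y) ∧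
      (inp a b P).subst s = inp (s a) b' (P.subst (Function.update s b b')) :=
  ⟨_, fun _ hy e => freshen_notMem _ b (e ▸ Finset.mem_image_of_mem s hy), rfl⟩

omit [Infinite N] in
theorem image_update_erase (s : N → N) (a a' : N) (A : Finset N) :
    (A.image (Function.update s a a')).erase a' ⊆ (A.erase a).image s := by
  intro x hx
  simp only [Finset.mem_erase, Finset.mem_image] at hx ⊢
  obtain ⟨h, y, hy, rfl⟩ := hx
  have hya : y ≠ a := by rintro rfl; simp at h
  exact ⟨y, ⟨hya, hy⟩, by simp [hya]⟩

theorem fn_subst_subset (P : Proc N) (s : N → N) : (P.subst s).fn ⊆ P.fn.image s := by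
  induction P generalizing s with
  | nil => simp [subst, fn]
  | ok => simp [subst, fn]
  | rep P ih => exact ih s
  | par P Q ihP ihQ =>
    simp only [subst, fn, Finset.image_union]
    exact Finset.union_subset_union (ihP s) (ihQ s)
  | out a b P ih =>
    simp only [subst, fn, Finset.image_insert]
    exact Finset.insert_subset_insert _ (Finset.insert_subset_insert _ (ih s))
  | res a P ih =>
    obtain ⟨a', -, e⟩ := exists_subst_res s a P
    rw [e]
    exact (Finset.erase_subset_erase _ (ih _)).trans (image_update_erase s a a' _)
  | inp a b P ih =>
    obtain ⟨b', -, e⟩ := exists_subst_inp s a b P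
    rw [e, fn, fn, Finset.image_insert]
    exact Finset.insert_subset_insert _
      ((Finset.erase_subset_erase _ (ih _)).trans (image_update_erase s b b' _))

-- The step under a binder: if two substitutions agree up to `π` and send the bound name to fresh
-- names `b` and `c`, they still agree up to a permutation, namely `π` followed by a transposition.
omit [Infinite N] in
theorem update_eqOn_swap_mul {s s' : N → N} {π : Equiv.Perm N} {A : Finset N} {a b c : N}
    (hb : ∀ y ∈ A.erase a, b ≠ s y) (hc : ∀ y ∈ A.erase a, c ≠ s' y)
    (h : ∀ y ∈ A.erase a, s' y = π (s y)) :
    ∀ y ∈ A, Function.update s' a c y =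
      (Equiv.swap (π b) c * π) (Function.update s a b y) := by
  refine swap_mul_eqOn (x := a) ?_ ?_ ?_ (by simp) (by simp)
  all_goals
    intro y hy
    have hne : y ≠ a := (Finset.mem_erase.1 hy).1
    simp only [Function.update_of_ne hne]
  · exact fun e => hb y hy (π.injective e)
  · exact hc y hy
  · exact h y hy

theorem notMem_fn_subst_perm {s s' : N → N} {π : Equiv.Perm N} {P : Proc N} {a b c : N}
    (hc : ∀ y ∈ P.fn.erase a, c ≠ s' y) (h : ∀ y ∈ P.fn.erase a, s' y = π (s y)) :
    c ∉ ((P.subst (Function.update s a b)).perm π).fn.erase (π b) := by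
  rw [fn_perm, ← Finset.image_erase π.injective]
  simp only [Finset.mem_image, not_exists, not_and]
  intro x hx e
  obtain ⟨y, hy, rfl⟩ := Finset.mem_image.1 (image_update_erase s a b _
    (Finset.erase_subset_erase _ (fn_subst_subset P _) hx))
  exact hc y hy (by rw [h y hy, e])

/-- The outer permutation absorbs the difference between the fresh names chosen by the two
substitutions. This is what lets the induction pass binders; the case `π = 1` then shows that only
the values on free names matter. -/
theorem alpha_subst_perm {P : Proc N} {s s' : N → N} {π : Equiv.Perm N}
    (h : ∀ x ∈ P.fn, s' x = π (s x)) : Alpha ((P.subst s).perm π) (P.subst s') := by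
  induction P generalizing s s' π with
  | nil => exact .refl _
  | par P Q ihP ihQ =>
    exact .par (ihP fun x hx => h x (by simp [fn, hx])) (ihQ fun x hx => h x (by simp [fn, hx]))
  | rep P ih => exact .rep (ih h)
  | ok => exact .refl _
  | out a b P ih =>
    simp only [subst, perm, h a (by simp [fn]), h b (by simp [fn])]
    exact .out _ _ (ih fun x hx => h x (by simp [fn, hx]))
  | res a P ih =>
    obtain ⟨b, hb, e⟩ := exists_subst_res s a P
    obtain ⟨c, hc, e'⟩ := exists_subst_res s' a P
    rw [e, e']
    refine .res_rebind (notMem_fn_subst_perm hc h) ?_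
    rw [perm_perm]
    exact ih (update_eqOn_swap_mul hb hc h)
  | inp a d P ih =>
    have h' : ∀ x ∈ P.fn.erase d, s' x = π (s x) := fun x hx => h x (Finset.mem_insert_of_mem hx)
    obtain ⟨b, hb, e⟩ := exists_subst_inp s a d P
    obtain ⟨c, hc, e'⟩ := exists_subst_inp s' a d P
    rw [e, e', h a (by simp [fn])]
    refine .inp_rebind (notMem_fn_subst_perm hc h') ?_
    rw [perm_perm]
    exact ih (update_eqOn_swap_mul hb hc h')

theorem alpha_subst_of_eqOn {P : Proc N} {s s' : N → N} (h : ∀ x ∈ P.fn, s' x = s x) :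
    Alpha (P.subst s) (P.subst s') := by
  have := alpha_subst_perm (P := P) (s := s) (s' := s') (π := 1) (by simpa using h)
  rwa [perm_one] at this

theorem alpha_res_subst {P : Proc N} {s s' : N → N} {a b c : N}
    (hb : ∀ y ∈ P.fn.erase a, b ≠ s y) (hc : ∀ y ∈ P.fn.erase a, c ≠ s' y)
    (h : ∀ y ∈ P.fn.erase a, s' y = s y) :
    Alpha (res b (P.subst (Function.update s a b))) (res c (P.subst (Function.update s' a c))) := by
  have h1 := notMem_fn_subst_perm (π := 1) (b := b) hc (by simpa using h)
  have h2 := update_eqOn_swap_mul (π := 1) hb hc (by simpa using h)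
  rw [perm_one] at h1
  exact .res_rebind h1 (alpha_subst_perm (by simpa using h2))

theorem alpha_inp_subst {P : Proc N} {s s' : N → N} {a b c d : N}
    (hb : ∀ y ∈ P.fn.erase a, b ≠ s y) (hc : ∀ y ∈ P.fn.erase a, c ≠ s' y)
    (h : ∀ y ∈ P.fn.erase a, s' y = s y) :
    Alpha (inp d b (P.subst (Function.update s a b)))
      (inp d c (P.subst (Function.update s' a c))) := by
  have h1 := notMem_fn_subst_perm (π := 1) (b := b) hc (by simpa using h)
  have h2 := update_eqOn_swap_mul (π := 1) hb hc (by simpa using h)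
  rw [perm_one] at h1
  exact .inp_rebind h1 (alpha_subst_perm (by simpa using h2))

omit [Infinite N] in
theorem update_apply_perm {s s' : N → N} {π : Equiv.Perm N} {A : Finset N} {a b : N}
    (h : ∀ y ∈ A.erase a, s' y = s (π y)) :
    ∀ y ∈ A, Function.update s' a b y = Function.update s (π a) b (π y) := by
  intro y hy
  by_cases hya : y = a
  · subst hya; simp
  · simp [hya, h y (by simp [hy, hya])]

theorem alpha_perm_subst {P : Proc N} {s s' : N → N} {π : Equiv.Perm N}
    (h : ∀ x ∈ P.fn, s' x = s (π x)) : Alpha ((P.perm π).subst s) (P.subst s') := by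
  induction P generalizing s s' π with
  | nil => exact .refl _
  | par P Q ihP ihQ =>
    exact .par (ihP fun x hx => h x (by simp [fn, hx])) (ihQ fun x hx => h x (by simp [fn, hx]))
  | rep P ih => exact .rep (ih h)
  | ok => exact .refl _
  | out a b P ih =>
    simp only [subst, perm, h a (by simp [fn]), h b (by simp [fn])]
    exact .out _ _ (ih fun x hx => h x (by simp [fn, hx]))
  | res a P ih =>
    obtain ⟨b, hb, e⟩ := exists_subst_res s (π a) (P.perm π)
    obtain ⟨c, hc, e'⟩ := exists_subst_res s' a P
    rw [perm, e, e']
    refine (Alpha.res _ (ih (update_apply_perm h))).trans (alpha_res_subst ?_ hc fun _ _ => rfl)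
    intro y hy
    rw [h y hy]
    refine hb _ ?_
    rw [fn_perm, ← Finset.image_erase π.injective]
    exact Finset.mem_image_of_mem _ hy
  | inp a d P ih =>
    have h' : ∀ x ∈ P.fn.erase d, s' x = s (π x) := fun x hx => h x (Finset.mem_insert_of_mem hx)
    obtain ⟨b, hb, e⟩ := exists_subst_inp s (π a) (π d) (P.perm π)
    obtain ⟨c, hc, e'⟩ := exists_subst_inp s' a d P
    rw [perm, e, e', h a (by simp [fn])]
    refine (Alpha.inp _ _ (ih (update_apply_perm h'))).trans
      (alpha_inp_subst ?_ hc fun _ _ => rfl)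
    intro y hy
    rw [h' y hy]
    refine hb _ ?_
    rw [fn_perm, ← Finset.image_erase π.injective]
    exact Finset.mem_image_of_mem _ hy

theorem alpha_subst_of_eqOn_id {P : Proc N} {s : N → N} (h : ∀ x ∈ P.fn, s x = x) :
    Alpha (P.subst s) P := by
  induction P generalizing s with
  | nil => exact .refl _
  | par P Q ihP ihQ =>
    exact .par (ihP fun x hx => h x (by simp [fn, hx])) (ihQ fun x hx => h x (by simp [fn, hx]))
  | rep P ih => exact .rep (ih h)
  | ok => exact .refl _
  | out a b P ih =>
    simp only [subst, h a (by simp [fn]), h b (by simp [fn])]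
    exact .out _ _ (ih fun x hx => h x (by simp [fn, hx]))
  | res a P ih =>
    obtain ⟨b, hb, e⟩ := exists_subst_res s a P
    rw [e]
    -- The old bound name `a` is itself a fresh choice, because `s` fixes the other free names.
    refine (alpha_res_subst (s' := s) (c := a) hb ?_ fun _ _ => rfl).trans (.res _ (ih ?_))
    · intro y hy
      rw [h y hy]
      exact (Finset.mem_erase.1 hy).1.symm
    · intro x hx
      by_cases hxa : x = a
      · subst hxa; simp
      · simp [hxa, h x (by simp [fn, hx, hxa])]
  | inp d a P ih =>
    have h' : ∀ x ∈ P.fn.erase a, s x = x := fun x hx => h x (Finset.mem_insert_of_mem hx)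
    obtain ⟨b, hb, e⟩ := exists_subst_inp s d a P
    rw [e, h d (by simp [fn])]
    refine (alpha_inp_subst (s' := s) (c := a) hb ?_ fun _ _ => rfl).trans (.inp _ _ (ih ?_))
    · intro y hy
      rw [h' y hy]
      exact (Finset.mem_erase.1 hy).1.symm
    · intro x hx
      by_cases hxa : x = a
      · subst hxa; simp
      · simp [hxa, h' x (by simp [hx, hxa])]

/-- Used to see that decoded reducts of a translation keep their free names in the range of `f`. -/
theorem Red.fn_subset {P Q : Proc N} (h : Red P Q) : Q.fn ⊆ P.fn := by
  induction h with
  | comm a b c P Q =>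
    have := fn_subst_subset P (Function.update id b c)
    intro x hx
    simp only [fn, Finset.mem_union, Finset.mem_insert, Finset.mem_erase] at hx ⊢
    rcases hx with hx | hx
    · obtain ⟨y, hy, rfl⟩ := Finset.mem_image.1 (this hx)
      by_cases hyb : y = b
      · subst hyb; simp
      · simp [hyb, hy]
    · simp [hx]
  | par Q _ ih => exact Finset.union_subset_union ih (Finset.Subset.refl _)
  | res a _ ih => exact Finset.erase_subset_erase _ ih
  | struct h₁ _ h₂ ih => rwa [h₁.fn_eq, ← h₂.fn_eq]

theorem Red.perm {P Q : Proc N} (h : Red P Q) (π : Equiv.Perm N) :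
    Red (P.perm π) (Q.perm π) := by
  induction h with
  | comm a b c P Q =>
    refine .struct (.refl _) (.comm (π a) (π b) (π c) (P.perm π) (Q.perm π))
      (.alpha (.par ?_ (.refl _)))
    refine (alpha_perm_subst fun x _ => rfl).trans (.symm (alpha_subst_perm fun x _ => ?_))
    by_cases hx : x = b
    · subst hx; simp
    · simp [hx]
  | par Q _ ih => exact .par _ ih
  | res a _ ih => exact .res _ ih
  | struct h₁ _ h₂ ih => exact .struct (h₁.perm π) ih (h₂.perm π)

end Subst

end PiCalc.Proc

/-! ### CPC: permutations, alpha-equivalence and renaming. -/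

namespace CPC

variable {N : Type u}

namespace Pattern

theorem act_act (p : Pattern N) (s t F G : N → N) :
    (p.act (fun x => .var (s x)) F).act (fun x => .var (t x)) G =
      p.act (fun x => .var (t (s x))) fun x => G (F x) := by
  induction p <;> simp_all [act, Comm.toPattern, Comm.protect]

theorem act_id (p : Pattern N) : p.act .var id = p := by
  induction p <;> simp_all [act, Comm.toPattern, Comm.protect]

theorem fn_comp [DecidableEq N] (p q : Pattern N) : (comp p q).fn = p.fn ∪ q.fn := by
  simp only [fn, vn, pn]
  ac_rfl

theorem fn_act [DecidableEq N] (p : Pattern N) (s F : N → N) :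
    (p.act (fun x => .var (s x)) F).fn = p.fn.image s := by
  induction p with
  | comp p q ihp ihq => rw [act, fn_comp, ihp, ihq, fn_comp, Finset.image_union]
  | _ => simp [act, Comm.toPattern, Comm.protect, fn, vn, pn]

theorem act_congr [DecidableEq N] {p : Pattern N} {s t F G : N → N} (h : ∀ x ∈ p.fn, t x = s x)
    (h' : ∀ x ∈ p.bn, G x = F x) :
    p.act (fun x => .var (s x)) F = p.act (fun x => .var (t x)) G := by
  induction p with
  | comp p q ihp ihq =>
    simp only [act]
    rw [ihp (fun x hx => h x (by simp [fn_comp, hx])) (fun x hx => h' x (by simp [bn, hx])),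
      ihq (fun x hx => h x (by simp [fn_comp, hx])) (fun x hx => h' x (by simp [bn, hx]))]
  | bind x => simp [act, h' x (by simp [bn])]
  | var x => simp [act, Comm.toPattern, h x (by simp [fn, vn])]
  | prot x => simp [act, Comm.protect, h x (by simp [fn, pn])]

end Pattern

namespace Proc

/-- The distinctness proof inside `case` depends on the pattern, which blocks plain rewriting. -/
theorem case_congr {p q : Pattern N} (e : p = q) {P Q : Proc N} (e' : P = Q) (hp : p.bn.Nodup)
    (hq : q.bn.Nodup) : case p hp P = case q hq Q := by
  subst e e'; rfl

theorem perm_perm (P : Proc N) (π ρ : Equiv.Perm N) : (P.perm π).perm ρ = P.perm (ρ * π) := by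
  induction P with
  | case p hp P ih => exact case_congr (Pattern.act_act _ _ _ _ _) ih _ _
  | _ => simp_all [perm]

theorem perm_one (P : Proc N) : P.perm 1 = P := by
  induction P with
  | case p hp P ih => exact case_congr (Pattern.act_id _) ih _ _
  | _ => simp_all [perm]

variable [DecidableEq N]

theorem fn_perm (P : Proc N) (π : Equiv.Perm N) : (P.perm π).fn = P.fn.image π := by
  induction P with
  | case p hp P ih =>
    simp only [perm, fn, ih, Pattern.fn_act, Pattern.bn_act, Finset.image_union,
      Finset.image_sdiff _ _ π.injective]
    congr 2
    ext; simp
  | _ => simp_all [perm, fn, Finset.image_union, Finset.image_erase π.injective]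

theorem Alpha.fn_eq {P Q : Proc N} (h : Alpha P Q) : P.fn = Q.fn := by
  induction h with
  | rename_case p hp P π h =>
    have e : (p.act .var π).fn = p.fn := (Pattern.fn_act p id π).trans Finset.image_id
    have e' : (p.act .var π).bn.toFinset = p.bn.toFinset.image π := by
      rw [Pattern.bn_act]; ext; simp
    rw [fn, fn, fn_perm, e, e', ← Finset.image_sdiff _ _ π.injective]
    congr 1
    have : ∀ x ∈ P.fn \ p.bn.toFinset, π x = id x := by simpa using h
    rw [Finset.image_congr (fun x hx => this x hx), Finset.image_id]
  | _ => simp_all [fn, fn_perm, PiCalc.Proc.image_swap_erase]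

theorem SEquiv.refl (P : Proc N) : SEquiv P P := .alpha (.refl P)

theorem SEquiv.fn_eq {P Q : Proc N} (h : SEquiv P Q) : P.fn = Q.fn := by
  induction h with
  | alpha h => exact h.fn_eq
  | par_comm => simp [fn, Finset.union_comm]
  | par_assoc => simp [fn]
  | res_comm => simp [fn, Finset.erase_right_comm]
  | extrude a P Q ha => simp [fn, Finset.erase_union_distrib, Finset.erase_eq_of_notMem ha]
  | _ => simp_all [fn]

theorem Alpha.res_rebind {a c : N} {P Q : Proc N} (hc : c ∉ P.fn.erase a)
    (h : Alpha (P.perm (Equiv.swap a c)) Q) : Alpha (Proc.res a P) (Proc.res c Q) := by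
  by_cases hac : c = a
  · subst hac
    rw [Equiv.swap_self] at h
    exact .res _ (by simpa using (perm_one P) ▸ h)
  · exact (Alpha.rename_res a c P (by simpa [hac] using hc)).trans (.res _ h)

theorem Alpha.case_rebind {p q : Pattern N} {hp : p.bn.Nodup} {hq : q.bn.Nodup} {P Q : Proc N}
    {κ : Equiv.Perm N} (hκ : ∀ x ∈ P.fn, x ∉ p.bn → κ x = x) (e : p.act .var κ = q)
    (h : Alpha (P.perm κ) Q) : Alpha (Proc.case p hp P) (Proc.case q hq Q) := by
  subst e
  exact (Alpha.rename_case p hp P κ hκ).trans (.case _ _ h)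

section Rename

variable [Infinite N]

/-- Substitution of names for names. -/
noncomputable def rename (s : N → N) (P : Proc N) : Proc N := P.subst fun x => .var (s x)

/-- The substitution `s`, changed to `F` on the names of a list. -/
def override (l : List N) (F s : N → N) (x : N) : N := if x ∈ l then F x else s x

theorem exists_rename_res (s : N → N) (a : N) (P : Proc N) :
    ∃ a', (∀ y ∈ P.fn.erase a, a' ≠ s y) ∧
      (res a P).rename s = res a' (P.rename (Function.update s a a')) := by
  refine ⟨freshen ((P.fn.erase a).biUnion fun x => (Comm.var (s x)).names) a, ?_, ?_⟩
  · intro y hy e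
    refine freshen_notMem ((P.fn.erase a).biUnion fun x => (Comm.var (s x)).names) a ?_
    rw [e]
    exact Finset.mem_biUnion.2 ⟨y, hy, by simp [Comm.names]⟩
  · simp only [rename, subst]
    congr 2
    funext x
    by_cases hx : x = a
    · subst hx; simp
    · simp [hx]

theorem exists_rename_case (s : N → N) (p : Pattern N) (hp : p.bn.Nodup) (P : Proc N) :
    ∃ (F : N → N) (h : (p.act (fun x => .var (s x)) F).bn.Nodup), Function.Injective F ∧
      (∀ x, ∀ y ∈ P.fn, y ∉ p.bn → F x ≠ s y) ∧
      (case p hp P).rename s =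
        case (p.act (fun x => .var (s x)) F) h (P.rename (override p.bn F s)) := by
  refine ⟨freshen ((P.fn \ p.bn.toFinset).biUnion fun x => (Comm.var (s x)).names),
    Pattern.nodup_bn_act _ (freshen_injective _) hp, freshen_injective _, ?_, ?_⟩
  · intro x y hy hyp e
    refine freshen_notMem ((P.fn \ p.bn.toFinset).biUnion fun x => (Comm.var (s x)).names) x ?_
    rw [e]
    exact Finset.mem_biUnion.2 ⟨y, by simp [hy, hyp], by simp [Comm.names]⟩
  · simp only [rename, subst]
    refine case_congr rfl ?_ _ _
    congr 1
    funext x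
    simp only [override]
    split_ifs <;> rfl

theorem fn_rename_subset (P : Proc N) (s : N → N) : (P.rename s).fn ⊆ P.fn.image s := by
  induction P generalizing s with
  | nil => simp [rename, subst, fn]
  | ok => simp [rename, subst, fn]
  | rep P ih => exact ih s
  | par P Q ihP ihQ =>
    simp only [fn, Finset.image_union]
    exact Finset.union_subset_union (ihP s) (ihQ s)
  | res a P ih =>
    obtain ⟨a', -, e⟩ := exists_rename_res s a P
    rw [e]
    exact (Finset.erase_subset_erase _ (ih _)).trans
      (PiCalc.Proc.image_update_erase s a a' _)
  | case p hp P ih =>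
    obtain ⟨F, h, -, -, e⟩ := exists_rename_case s p hp P
    rw [e, fn, fn, Finset.image_union, Pattern.fn_act, Pattern.bn_act]
    refine Finset.union_subset_union (Finset.Subset.refl _) fun x hx => ?_
    obtain ⟨hx, hx'⟩ := Finset.mem_sdiff.1 hx
    obtain ⟨y, hy, rfl⟩ := Finset.mem_image.1 (ih _ hx)
    by_cases hyp : y ∈ p.bn
    · simp only [override, hyp, if_true, List.mem_toFinset, List.mem_map] at hx'
      exact (hx' ⟨y, hyp, rfl⟩).elim
    · simp only [override, hyp, if_false]
      exact Finset.mem_image_of_mem _ (by simp [hy, hyp])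

theorem notMem_fn_rename_perm {s s' : N → N} {π : Equiv.Perm N} {P : Proc N} {a b c : N}
    (hc : ∀ y ∈ P.fn.erase a, c ≠ s' y) (h : ∀ y ∈ P.fn.erase a, s' y = π (s y)) :
    c ∉ ((P.rename (Function.update s a b)).perm π).fn.erase (π b) := by
  rw [fn_perm, ← Finset.image_erase π.injective]
  simp only [Finset.mem_image, not_exists, not_and]
  intro x hx e
  obtain ⟨y, hy, rfl⟩ := Finset.mem_image.1 (PiCalc.Proc.image_update_erase s a b _
    (Finset.erase_subset_erase _ (fn_rename_subset P _) hx))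
  exact hc y hy (by rw [h y hy, e])

/-- A pattern may bind several names, so the transposition of the π-calculus case is replaced by a
permutation `κ` that sends each `π (F x)` to `G x` and fixes the images of the other free names. The
induction hypothesis is an argument so that the lemma serves both within the induction for
`alpha_rename_perm` and after it. -/
theorem alpha_case_rename_perm {P : Proc N}
    (ih : ∀ {s s' : N → N} {π : Equiv.Perm N}, (∀ x ∈ P.fn, s' x = π (s x)) →
      Alpha ((P.rename s).perm π) (P.rename s'))
    {p : Pattern N} {s s' F G : N → N} {π : Equiv.Perm N} (hF : Set.InjOn F {x | x ∈ p.bn})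
    (hG : Set.InjOn G {x | x ∈ p.bn})
    (hFs : ∀ x ∈ p.bn, ∀ y ∈ P.fn, y ∉ p.bn → F x ≠ s y)
    (hGs : ∀ x ∈ p.bn, ∀ y ∈ P.fn, y ∉ p.bn → G x ≠ s' y)
    (hp : ∀ x ∈ p.fn, s' x = π (s x)) (hP : ∀ x ∈ P.fn, x ∉ p.bn → s' x = π (s x))
    (h₁ : (p.act (fun x => .var (s x)) F).bn.Nodup)
    (h₂ : (p.act (fun x => .var (s' x)) G).bn.Nodup) :
    Alpha ((case (p.act (fun x => .var (s x)) F) h₁ (P.rename (override p.bn F s))).perm π)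
      (case (p.act (fun x => .var (s' x)) G) h₂ (P.rename (override p.bn G s'))) := by
  obtain ⟨κ, hκ, hκ'⟩ := exists_perm_extending p.bn.toFinset
    ((P.fn.filter (· ∉ p.bn)).image s') (fun x => π (F x)) G
    (fun x hx y hy e => hF (by simpa using hx) (by simpa using hy) (π.injective e))
    (fun x hx y hy e => hG (by simpa using hx) (by simpa using hy) e)
    (by
      intro x hx h
      obtain ⟨y, hy, e⟩ := Finset.mem_image.1 h
      obtain ⟨hy, hyp⟩ := Finset.mem_filter.1 hy
      rw [hP y hy hyp] at e
      exact hFs x (by simpa using hx) y hy hyp (π.injective e).symm)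
    (by
      intro x hx h
      obtain ⟨y, hy, e⟩ := Finset.mem_image.1 h
      obtain ⟨hy, hyp⟩ := Finset.mem_filter.1 hy
      exact hGs x (by simpa using hx) y hy hyp e.symm)
  simp only [List.mem_toFinset] at hκ
  have hX : ∀ y ∈ P.fn, y ∉ p.bn → κ (s' y) = s' y := fun y hy hyp =>
    hκ' _ (Finset.mem_image_of_mem _ (by simp [hy, hyp]))
  refine Alpha.case_rebind (κ := κ) ?_ ?_ ?_
  · intro x hx hxb
    rw [fn_perm] at hx
    obtain ⟨z, hz, rfl⟩ := Finset.mem_image.1 hx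
    obtain ⟨y, hy, rfl⟩ := Finset.mem_image.1 (fn_rename_subset _ _ hz)
    by_cases hyp : y ∈ p.bn
    · simp only [override, hyp, if_true, Pattern.bn_act, List.map_map, List.mem_map] at hxb
      exact (hxb ⟨y, hyp, rfl⟩).elim
    · simp only [override, hyp, if_false]
      rw [← hP y hy hyp, hX y hy hyp]
  -- Alpha-conversion of a case changes only the binding names of its pattern; hence `id` on the
  -- free ones.
  · have := Pattern.act_act p (fun x => π (s x)) id (fun x => π (F x)) κ
    rw [Pattern.act_act p s π F π]
    refine this.trans ?_
    exact Pattern.act_congr hp fun x hx => (hκ x hx).symm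
  · rw [perm_perm]
    refine ih fun x hx => ?_
    simp only [override, Equiv.Perm.mul_apply]
    split_ifs with hxp
    · exact (hκ x hxp).symm
    · rw [← hP x hx hxp, hX x hx hxp]

theorem alpha_rename_perm {P : Proc N} {s s' : N → N} {π : Equiv.Perm N}
    (h : ∀ x ∈ P.fn, s' x = π (s x)) : Alpha ((P.rename s).perm π) (P.rename s') := by
  induction P generalizing s s' π with
  | nil => exact .refl _
  | par P Q ihP ihQ =>
    exact .par (ihP fun x hx => h x (by simp [fn, hx])) (ihQ fun x hx => h x (by simp [fn, hx]))
  | rep P ih => exact .rep (ih h)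
  | ok => exact .refl _
  | res a P ih =>
    obtain ⟨b, hb, e⟩ := exists_rename_res s a P
    obtain ⟨c, hc, e'⟩ := exists_rename_res s' a P
    rw [e, e']
    refine .res_rebind (notMem_fn_rename_perm hc h) ?_
    rw [perm_perm]
    exact ih (PiCalc.Proc.update_eqOn_swap_mul hb hc h)
  | case p hp P ih =>
    obtain ⟨F, h₁, hF, hFs, e⟩ := exists_rename_case s p hp P
    obtain ⟨G, h₂, hG, hGs, e'⟩ := exists_rename_case s' p hp P
    rw [e, e']
    exact alpha_case_rename_perm ih hF.injOn hG.injOn (fun x _ => hFs x) (fun x _ => hGs x)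
      (fun x hx => h x (by simp [fn, hx])) (fun x hx hxp => h x (by simp [fn, hx, hxp])) _ _

theorem alpha_res_rename {P : Proc N} {s : N → N} {a b c : N}
    (hb : ∀ y ∈ P.fn.erase a, b ≠ s y) (hc : ∀ y ∈ P.fn.erase a, c ≠ s y) :
    Alpha (res b (P.rename (Function.update s a b)))
      (res c (P.rename (Function.update s a c))) := by
  have h1 := notMem_fn_rename_perm (s := s) (π := 1) (b := b) hc (by simp)
  have h2 := PiCalc.Proc.update_eqOn_swap_mul (s := s) (π := 1) hb hc (by simp)
  rw [perm_one] at h1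
  exact .res_rebind h1 (alpha_rename_perm (by simpa using h2))

theorem alpha_case_rename {P : Proc N} {p : Pattern N} {s F G : N → N}
    (hF : Set.InjOn F {x | x ∈ p.bn}) (hG : Set.InjOn G {x | x ∈ p.bn})
    (hFs : ∀ x ∈ p.bn, ∀ y ∈ P.fn, y ∉ p.bn → F x ≠ s y)
    (hGs : ∀ x ∈ p.bn, ∀ y ∈ P.fn, y ∉ p.bn → G x ≠ s y)
    (h₁ : (p.act (fun x => .var (s x)) F).bn.Nodup)
    (h₂ : (p.act (fun x => .var (s x)) G).bn.Nodup) :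
    Alpha (case (p.act (fun x => .var (s x)) F) h₁ (P.rename (override p.bn F s)))
      (case (p.act (fun x => .var (s x)) G) h₂ (P.rename (override p.bn G s))) := by
  have := alpha_case_rename_perm alpha_rename_perm (π := 1) hF hG hFs hGs
    (by simp) (by simp) h₁ h₂
  rwa [perm_one] at this

end Rename

theorem SEquiv.fill {k : ℕ} {P Q : Fin k → Proc N} (h : ∀ i, SEquiv (P i) (Q i))
    (C : Ctx N k) :
    SEquiv (C.fill P) (C.fill Q) := by
  induction C with
  | hole i => exact h i
  | nil => exact .refl _
  | ok => exact .refl _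
  | par C D ihC ihD => exact .par ihC ihD
  | rep C ih => exact .rep ih
  | res a C ih => exact .res _ ih
  | case p hp C ih => exact .case _ _ ih

/-- Structural equivalence is a barbed congruence. -/
theorem SEquiv.isBarbedRel [Infinite N] : IsBarbedRel (SEquiv (N := N)) where
  symm _ _ h := h.symm
  barb _ _ h m := by
    rintro ⟨l, p, hp, P', P'', h', hm⟩
    exact ⟨l, p, hp, P', P'', h.symm.trans h', hm⟩
  ok _ _ h := fun ⟨P', h'⟩ => ⟨P', h.symm.trans h'⟩
  red _ _ h P' h' := ⟨P', .struct h.symm h' (.refl _), .refl _⟩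
  ctx _ _ h C _ := .fill (fun _ => h) C

theorem SEquiv.bequiv [Infinite N] {P Q : Proc N} (h : SEquiv P Q) : BEquiv P Q :=
  ⟨_, SEquiv.isBarbedRel, h⟩

/-! ### Sorted processes and their decoding. -/

/-- Processes whose prefixes all have the shape of a translated input or output, where `c` holds
the names that may stand in the last position of an input. Such names are never used as channels,
and below an output only its own last name is used in that way. -/
def Sorted : Set N → Proc N → Prop
  | _, nil => True
  | c, par P Q => P.Sorted c ∧ Q.Sorted c
  | c, rep P => P.Sorted c
  | c, res a P => P.Sorted (c \ {a})
  | c, case p _ P =>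
      (∃ x y z, p = inputPattern x y z ∧ x ∉ c ∧ z ∈ c ∧ P.Sorted (c \ {y})) ∨
      -- In the continuation of an output, `z` takes over the role of `c`; communication will
      -- replace it by an element of `c`.
      ∃ x y z, p = outputPattern x y z ∧ x ∉ c ∧ y ∉ c ∧ (∀ m ∈ P.fn, m ∈ c → m = z) ∧
        P.Sorted {z}
  | _, ok => True

omit [DecidableEq N] in
/-- The pi-calculus process that arises by dropping the last components of all patterns. -/
def decode : Proc N → PiCalc.Proc N
  | nil => .nil
  | par P Q => .par P.decode Q.decode
  | rep P => .rep P.decode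
  | res a P => .res a P.decode
  | case p _ P =>
      match p with
      | .comp (.comp (.var x) (.bind y)) (.var _) => .inp x y P.decode
      | .comp (.comp (.var x) (.var y)) (.bind _) => .out x y P.decode
      -- A default value: no other pattern occurs in a sorted process.
      | _ => .nil
  | ok => .ok

theorem mem_fn_input {x y z m : N} {hp : (inputPattern x y z).bn.Nodup} {P : Proc N} :
    m ∈ (case (inputPattern x y z) hp P).fn ↔ m = x ∨ m = z ∨ m ∈ P.fn ∧ m ≠ y := by
  simp [fn, inputPattern, Pattern.fn, Pattern.vn, Pattern.pn, Pattern.bn]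

theorem mem_fn_output {x y z m : N} {hp : (outputPattern x y z).bn.Nodup} {P : Proc N} :
    m ∈ (case (outputPattern x y z) hp P).fn ↔ m = x ∨ m = y ∨ m ∈ P.fn ∧ m ≠ z := by
  simp [fn, outputPattern, Pattern.fn, Pattern.vn, Pattern.pn, Pattern.bn]

/-- Free names in `c` occur only in the last positions, which decoding erases. Freshness conditions
thus pass from a process to its decoding, and forgetting the binder `λ z` of an output releases no
name. -/
theorem Sorted.mem_fn_decode {c : Set N} {P : Proc N} (h : P.Sorted c) {m : N}
    (hm : m ∈ P.decode.fn) : m ∈ P.fn ∧ m ∉ c := by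
  induction P generalizing c with
  | nil => simp [decode, PiCalc.Proc.fn] at hm
  | ok => simp [decode, PiCalc.Proc.fn] at hm
  | rep P ih => exact ih h hm
  | par P Q ihP ihQ =>
    rcases Finset.mem_union.1 hm with hm | hm
    · exact ⟨Finset.mem_union_left _ (ihP h.1 hm).1, (ihP h.1 hm).2⟩
    · exact ⟨Finset.mem_union_right _ (ihQ h.2 hm).1, (ihQ h.2 hm).2⟩
  | res a P ih =>
    obtain ⟨hma, hm⟩ := Finset.mem_erase.1 hm
    have := ih h hm
    exact ⟨Finset.mem_erase.2 ⟨hma, this.1⟩, fun hc => this.2 ⟨hc, hma⟩⟩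
  | case p hp P ih =>
    rcases h with ⟨x, y, z, rfl, hx, hz, h⟩ | ⟨x, y, z, rfl, hx, hy, hc, h⟩
    · rw [mem_fn_input]
      rcases Finset.mem_insert.1 hm with rfl | hm
      · exact ⟨.inl rfl, hx⟩
      · obtain ⟨hma, hm⟩ := Finset.mem_erase.1 hm
        have := ih h hm
        exact ⟨.inr (.inr ⟨this.1, hma⟩), fun hc => this.2 ⟨hc, hma⟩⟩
    · rw [mem_fn_output]
      rcases Finset.mem_insert.1 hm with rfl | hm
      · exact ⟨.inl rfl, hx⟩
      rcases Finset.mem_insert.1 hm with rfl | hm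
      · exact ⟨.inr (.inl rfl), hy⟩
      · have := ih h hm
        exact ⟨.inr (.inr this), fun hm' => this.2 (hc m this.1 hm')⟩

/-- Sortedness depends on `c` only through the free names, so `c` and `c'` need to match only there.
-/
theorem Sorted.perm {c c' : Set N} {P : Proc N} {π : Equiv.Perm N} (h : P.Sorted c)
    (hc : ∀ x ∈ P.fn, x ∈ c ↔ π x ∈ c') : (P.perm π).Sorted c' := by
  induction P generalizing c c' with
  | nil => trivial
  | ok => trivial
  | rep P ih => exact ih h hc
  | par P Q ihP ihQ =>
    exact ⟨ihP h.1 fun x hx => hc x (by simp [fn, hx]),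
      ihQ h.2 fun x hx => hc x (by simp [fn, hx])⟩
  | res a P ih =>
    refine ih h fun x hx => ?_
    by_cases hxa : x = a
    · simp [hxa]
    · simpa [hxa] using hc x (by simp [fn, hx, hxa])
  | case p hp P ih =>
    rcases h with ⟨x, y, z, rfl, hx, hz, h⟩ | ⟨x, y, z, rfl, hx, hy, hz, h⟩
    · simp only [mem_fn_input] at hc
      refine .inl ⟨π x, π y, π z, rfl, ?_, ?_, ih h fun m hm => ?_⟩
      · rwa [← hc x (.inl rfl)]
      · rwa [← hc z (.inr (.inl rfl))]
      · by_cases hmy : m = y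
        · simp [hmy]
        · simpa [hmy] using hc m (.inr (.inr ⟨hm, hmy⟩))
    · simp only [mem_fn_output] at hc
      refine .inr ⟨π x, π y, π z, rfl, ?_, ?_, ?_, ih h fun m _ => ?_⟩
      · rwa [← hc x (.inl rfl)]
      · rwa [← hc y (.inr (.inl rfl))]
      · intro m hm hmc
        rw [fn_perm] at hm
        obtain ⟨w, hw, rfl⟩ := Finset.mem_image.1 hm
        by_contra hne
        have hwz : w ≠ z := fun e => hne (congrArg π e)
        exact hwz (hz w hw ((hc w (.inr (.inr ⟨hw, hwz⟩))).2 hmc))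
      · simp

theorem sorted_perm_iff {c c' : Set N} {P : Proc N} {π : Equiv.Perm N}
    (hc : ∀ x ∈ P.fn, x ∈ c ↔ π x ∈ c') : (P.perm π).Sorted c' ↔ P.Sorted c := by
  refine ⟨fun h => ?_, fun h => h.perm hc⟩
  have := h.perm (π := π⁻¹) (c' := c) ?_
  · rwa [perm_perm, inv_mul_cancel, perm_one] at this
  · intro x hx
    rw [fn_perm] at hx
    obtain ⟨w, hw, rfl⟩ := Finset.mem_image.1 hx
    simp [hc w hw]

theorem sorted_congr {c c' : Set N} {P : Proc N} (hc : ∀ x ∈ P.fn, x ∈ c ↔ x ∈ c') :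
    P.Sorted c' ↔ P.Sorted c := by
  have := sorted_perm_iff (P := P) (π := 1) (by simpa using hc)
  rwa [perm_one] at this

theorem Sorted.decode_perm {c : Set N} {P : Proc N} (h : P.Sorted c) (π : Equiv.Perm N) :
    (P.perm π).decode = P.decode.perm π := by
  induction P generalizing c with
  | nil => rfl
  | ok => rfl
  | rep P ih => exact congrArg _ (ih h)
  | par P Q ihP ihQ => exact congrArg₂ _ (ihP h.1) (ihQ h.2)
  | res a P ih => exact congrArg _ (ih h)
  | case p hp P ih =>
    rcases h with ⟨x, y, z, rfl, -, -, h⟩ | ⟨x, y, z, rfl, -, -, -, h⟩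
    · exact congrArg (PiCalc.Proc.inp (π x) (π y)) (ih h)
    · exact congrArg (PiCalc.Proc.out (π x) (π y)) (ih h)

/-- For an input, `π` agrees with the transposition of `y` and `π y` on the decoded continuation, so
the decodings differ by a renaming of the bound name. For an output, the decoded continuation lacks
`z`, so `π` fixes all its free names. -/
theorem Sorted.rename_case {c : Set N} {p : Pattern N} {hp : p.bn.Nodup} {P : Proc N}
    (h : (case p hp P).Sorted c) {π : Equiv.Perm N} (hπ : ∀ x ∈ P.fn, x ∉ p.bn → π x = x)
    (hq : (p.act .var π).bn.Nodup) :
    (case (p.act .var π) hq (P.perm π)).Sorted c ∧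
      PiCalc.Proc.Alpha (case p hp P).decode (case (p.act .var π) hq (P.perm π)).decode := by
  rcases h with ⟨x, y, z, rfl, hx, hz, h⟩ | ⟨x, y, z, rfl, hx, hy, hz, h⟩
  · have hπ' : ∀ w ∈ P.fn, w ≠ y → π w = w ∧ w ≠ π y := by
      intro w hw hwy
      have e := hπ w hw (by simpa [inputPattern, Pattern.bn] using hwy)
      exact ⟨e, fun e' => hwy (π.injective (e.trans e'))⟩
    refine ⟨.inl ⟨x, π y, z, rfl, hx, hz, h.perm fun w hw => ?_⟩, ?_⟩
    · by_cases hwy : w = y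
      · simp [hwy]
      · simp [hwy, hπ' w hw hwy]
    · change PiCalc.Proc.Alpha (.inp x y P.decode) (.inp x (π y) (P.perm π).decode)
      rw [h.decode_perm]
      refine .inp_rebind ?_ (PiCalc.Proc.alpha_perm_of_eqOn fun w hw => ?_)
      · intro hm
        obtain ⟨h1, h2⟩ := Finset.mem_erase.1 hm
        exact (hπ' _ (h.mem_fn_decode h2).1 h1).2 rfl
      · by_cases hwy : w = y
        · simp [hwy]
        · have := hπ' w (h.mem_fn_decode hw).1 hwy
          rw [Equiv.swap_apply_of_ne_of_ne hwy this.2, this.1]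
  · have hπ' : ∀ w ∈ P.fn, w ≠ z → π w = w := fun w hw hwz =>
      hπ w hw (by simpa [outputPattern, Pattern.bn] using hwz)
    refine ⟨.inr ⟨x, y, π z, rfl, hx, hy, ?_, h.perm fun w _ => by simp⟩, ?_⟩
    · intro m hm hmc
      rw [fn_perm] at hm
      obtain ⟨w, hw, rfl⟩ := Finset.mem_image.1 hm
      by_contra hne
      have hwz : w ≠ z := fun e => hne (congrArg π e)
      rw [hπ' w hw hwz] at hmc
      exact hwz (hz w hw hmc)
    · change PiCalc.Proc.Alpha (.out x y P.decode) (.out x y (P.perm π).decode)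
      rw [h.decode_perm]
      refine .out _ _ (PiCalc.Proc.alpha_perm_of_fixed fun w hw => ?_)
      exact hπ' w (h.mem_fn_decode hw).1 fun e => (h.mem_fn_decode hw).2 e

theorem sorted_rename_case_iff {c : Set N} {p : Pattern N} {hp : p.bn.Nodup} {P : Proc N}
    {π : Equiv.Perm N} (hπ : ∀ x ∈ P.fn, x ∉ p.bn → π x = x) (hq : (p.act .var π).bn.Nodup) :
    (case p hp P).Sorted c ↔ (case (p.act .var π) hq (P.perm π)).Sorted c := by
  refine ⟨fun h => (h.rename_case hπ hq).1, fun h => ?_⟩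
  have e : (p.act .var π).act .var (π⁻¹ : Equiv.Perm N) = p := by
    have := Pattern.act_act p id id π (π⁻¹ : Equiv.Perm N)
    refine this.trans (Eq.trans ?_ (Pattern.act_id p))
    congr 1
    funext x
    exact π.symm_apply_apply x
  have := (h.rename_case (π := π⁻¹) ?_ (by rwa [e])).1
  · rwa [case_congr (q := p) e (by rw [perm_perm, inv_mul_cancel, perm_one]) _ hp] at this
  · intro x hx hxb
    rw [fn_perm] at hx
    obtain ⟨w, hw, rfl⟩ := Finset.mem_image.1 hx
    have hwb : w ∉ p.bn := fun hw => hxb (by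
      rw [Pattern.bn_act]; exact List.mem_map_of_mem hw)
    exact (π.symm_apply_apply w).trans (hπ w hw hwb).symm

theorem swap_mem_diff_iff {c : Set N} {a d x : N} (hx : x ≠ d) :
    x ∈ c \ {a} ↔ Equiv.swap a d x ∈ c \ {d} := by
  by_cases hxa : x = a
  · simp [hxa]
  · simp [Equiv.swap_apply_of_ne_of_ne hxa hx, hx, hxa]

/-- Both claims are proved together: symmetry and transitivity need sortedness to be transported in
order to decode. -/
theorem Alpha.sorted_decode {T U : Proc N} (h : Alpha T U) (c : Set N) :
    (T.Sorted c ↔ U.Sorted c) ∧ (T.Sorted c → PiCalc.Proc.Alpha T.decode U.decode) := by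
  induction h generalizing c with
  | refl P => exact ⟨Iff.rfl, fun _ => .refl _⟩
  | symm _ ih => exact ⟨(ih c).1.symm, fun h => ((ih c).2 ((ih c).1.2 h)).symm⟩
  | trans _ _ ih₁ ih₂ =>
    exact ⟨(ih₁ c).1.trans (ih₂ c).1, fun h => ((ih₁ c).2 h).trans ((ih₂ c).2 ((ih₁ c).1.1 h))⟩
  | par _ _ ih₁ ih₂ =>
    exact ⟨and_congr (ih₁ c).1 (ih₂ c).1, fun h => .par ((ih₁ c).2 h.1) ((ih₂ c).2 h.2)⟩
  | rep _ ih => exact ⟨(ih c).1, fun h => .rep ((ih c).2 h)⟩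
  | res a _ ih => exact ⟨(ih _).1, fun h => .res _ ((ih _).2 h)⟩
  | case p hp hPQ ih =>
    refine ⟨by simp only [Sorted, hPQ.fn_eq, (ih _).1], ?_⟩
    rintro (⟨x, y, z, rfl, -, -, h⟩ | ⟨x, y, z, rfl, -, -, -, h⟩)
    · exact .inp _ _ ((ih _).2 h)
    · exact .out _ _ ((ih _).2 h)
  | rename_res a d P hd =>
    have hs : ∀ x ∈ P.fn, x ∈ c \ {a} ↔ Equiv.swap a d x ∈ c \ {d} := fun x hx =>
      swap_mem_diff_iff fun e => hd (e ▸ hx)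
    refine ⟨(sorted_perm_iff hs).symm, fun h => ?_⟩
    simp only [decode]
    rw [Sorted.decode_perm (P := P) h]
    exact .rename_res _ _ _ fun hm => hd (Sorted.mem_fn_decode (P := P) h hm).1
  | rename_case p hp P π hπ =>
    exact ⟨sorted_rename_case_iff hπ _, fun h => (h.rename_case hπ _).2⟩

theorem SEquiv.sorted_decode {T U : Proc N} (h : SEquiv T U) (c : Set N) :
    (T.Sorted c ↔ U.Sorted c) ∧ (T.Sorted c → PiCalc.Proc.SEquiv T.decode U.decode) := by
  induction h generalizing c with
  | alpha h => exact ⟨(h.sorted_decode c).1, fun h' => .alpha ((h.sorted_decode c).2 h')⟩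
  | symm _ ih => exact ⟨(ih c).1.symm, fun h => ((ih c).2 ((ih c).1.2 h)).symm⟩
  | trans _ _ ih₁ ih₂ =>
    exact ⟨(ih₁ c).1.trans (ih₂ c).1, fun h => ((ih₁ c).2 h).trans ((ih₂ c).2 ((ih₁ c).1.1 h))⟩
  | par _ _ ih₁ ih₂ =>
    exact ⟨and_congr (ih₁ c).1 (ih₂ c).1, fun h => .par ((ih₁ c).2 h.1) ((ih₂ c).2 h.2)⟩
  | rep _ ih => exact ⟨(ih c).1, fun h => .rep ((ih c).2 h)⟩
  | res a _ ih => exact ⟨(ih _).1, fun h => .res _ ((ih _).2 h)⟩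
  | case p hp hPQ ih =>
    refine ⟨by simp only [Sorted, hPQ.fn_eq, (ih _).1], ?_⟩
    rintro (⟨x, y, z, rfl, -, -, h⟩ | ⟨x, y, z, rfl, -, -, -, h⟩)
    · exact .inp _ _ ((ih _).2 h)
    · exact .out _ _ ((ih _).2 h)
  | par_nil P => exact ⟨by simp [Sorted], fun _ => .par_nil _⟩
  | par_comm P Q => exact ⟨by simp [Sorted, and_comm], fun _ => .par_comm _ _⟩
  | par_assoc P Q R => exact ⟨by simp [Sorted, and_assoc], fun _ => .par_assoc _ _ _⟩
  | rep_unfold P => exact ⟨by simp [Sorted], fun _ => .rep_unfold _⟩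
  | res_nil a => exact ⟨by simp [Sorted], fun _ => .res_nil _⟩
  | res_comm a b P =>
    exact ⟨by simp only [Sorted, Set.sdiff_sdiff, Set.union_comm], fun _ => .res_comm _ _ _⟩
  | extrude a P Q ha =>
    -- Since `a` is not free in `P`, the sets `c` and `c \ {a}` agree on the free names of `P`.
    refine ⟨and_congr_left' ((sorted_congr fun x hx => ?_).symm.symm), fun h => ?_⟩
    · have : x ≠ a := fun e => ha (e ▸ hx)
      simp [this]
    · exact .extrude _ _ _ fun hm => ha (Sorted.mem_fn_decode h.1 hm).1

section Rename

variable [Infinite N]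

omit [Infinite N] in
theorem override_singleton (a : N) (F s : N → N) :
    override [a] F s = Function.update s a (F a) := by
  funext x
  by_cases hx : x = a
  · simp [override, hx]
  · simp [override, hx]

theorem exists_rename_input (s : N → N) (x y z : N) (hp : (inputPattern x y z).bn.Nodup)
    (P : Proc N) : ∃ y', (∀ w ∈ P.fn.erase y, y' ≠ s w) ∧
      (case (inputPattern x y z) hp P).rename s =
        case (inputPattern (s x) y' (s z)) (inputPattern_nodup _ _ _)
          (P.rename (Function.update s y y')) := by
  obtain ⟨F, h, -, hF, e⟩ := exists_rename_case s _ hp P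
  refine ⟨F y, fun w hw => ?_, ?_⟩
  · obtain ⟨h1, h2⟩ := Finset.mem_erase.1 hw
    exact hF y w h2 (by simpa [inputPattern, Pattern.bn] using h1)
  · rw [e, ← override_singleton]; rfl

theorem exists_rename_output (s : N → N) (x y z : N) (hp : (outputPattern x y z).bn.Nodup)
    (P : Proc N) : ∃ z', (∀ w ∈ P.fn.erase z, z' ≠ s w) ∧
      (case (outputPattern x y z) hp P).rename s =
        case (outputPattern (s x) (s y) z') (outputPattern_nodup _ _ _)
          (P.rename (Function.update s z z')) := by
  obtain ⟨F, h, -, hF, e⟩ := exists_rename_case s _ hp P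
  refine ⟨F z, fun w hw => ?_, ?_⟩
  · obtain ⟨h1, h2⟩ := Finset.mem_erase.1 hw
    exact hF z w h2 (by simpa [outputPattern, Pattern.bn] using h1)
  · rw [e, ← override_singleton]; rfl

end Rename

end Proc
end CPC

/-! ### Reductions of sorted processes. -/

namespace CPC.Proc

variable {N : Type u} [DecidableEq N] [Infinite N]

/-- Unlike a permutation, `s` may identify names, as communication does. It is enough that it
respects the division of the free names by `c`. -/
theorem Sorted.rename {c c' : Set N} {P : Proc N} {s : N → N} (h : P.Sorted c)
    (hc : ∀ x ∈ P.fn, x ∈ c ↔ s x ∈ c') : (P.rename s).Sorted c' := by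
  induction P generalizing c c' s with
  | nil => trivial
  | ok => trivial
  | rep P ih => exact ih h hc
  | par P Q ihP ihQ =>
    exact ⟨ihP h.1 fun x hx => hc x (by simp [fn, hx]),
      ihQ h.2 fun x hx => hc x (by simp [fn, hx])⟩
  | res a P ih =>
    obtain ⟨a', ha', e⟩ := exists_rename_res s a P
    rw [e]
    refine ih h fun x hx => ?_
    by_cases hxa : x = a
    · simp [hxa]
    · have hx' : x ∈ P.fn.erase a := by simp [hx, hxa]
      simpa [hxa, (ha' x hx').symm] using hc x hx'
  | case p hp P ih =>
    rcases h with ⟨x, y, z, rfl, hx, hz, h⟩ | ⟨x, y, z, rfl, hx, hy, hz, h⟩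
    · simp only [mem_fn_input] at hc
      obtain ⟨y', hy', e⟩ := exists_rename_input s x y z hp P
      rw [e]
      refine .inl ⟨_, _, _, rfl, ?_, ?_, ih h fun m hm => ?_⟩
      · rwa [← hc x (.inl rfl)]
      · rwa [← hc z (.inr (.inl rfl))]
      · by_cases hmy : m = y
        · simp [hmy]
        · simpa [hmy, (hy' m (by simp [hm, hmy])).symm] using hc m (.inr (.inr ⟨hm, hmy⟩))
    · simp only [mem_fn_output] at hc
      obtain ⟨z', hz', e⟩ := exists_rename_output s x y z hp P
      rw [e]
      refine .inr ⟨_, _, _, rfl, ?_, ?_, ?_, ih h fun m hm => ?_⟩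
      · rwa [← hc x (.inl rfl)]
      · rwa [← hc y (.inr (.inl rfl))]
      · intro m hm hmc
        obtain ⟨w, hw, rfl⟩ := Finset.mem_image.1 (fn_rename_subset _ _ hm)
        by_cases hwz : w = z
        · simp [hwz]
        · rw [Function.update_of_ne hwz] at hmc
          exact (hwz (hz w hw ((hc w (.inr (.inr ⟨hw, hwz⟩))).2 hmc))).elim
      · by_cases hmz : m = z
        · simp [hmz]
        · simp [hmz, (hz' m (by simp [hm, hmz])).symm]

theorem Sorted.decode_rename {c : Set N} {P : Proc N} (h : P.Sorted c) (s : N → N) :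
    PiCalc.Proc.Alpha (P.rename s).decode (P.decode.subst s) := by
  induction P generalizing c s with
  | nil => exact .refl _
  | ok => exact .refl _
  | rep P ih => exact .rep (ih h s)
  | par P Q ihP ihQ => exact .par (ihP h.1 s) (ihQ h.2 s)
  | res a P ih =>
    obtain ⟨a', ha', e⟩ := exists_rename_res s a P
    obtain ⟨b, hb, e'⟩ := PiCalc.Proc.exists_subst_res s a P.decode
    rw [e, decode, decode, e']
    refine (PiCalc.Proc.Alpha.res _ (ih h _)).trans
      (PiCalc.Proc.alpha_res_subst (fun y hy => ha' y ?_) hb fun _ _ => rfl)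
    -- A name chosen fresh for the scope is fresh for the decoded scope, which has no further free
    -- names.
    exact Finset.erase_subset_erase _ (fun x hx => (Sorted.mem_fn_decode (P := P) h hx).1) hy
  | case p hp P ih =>
    rcases h with ⟨x, y, z, rfl, hx, hz, h⟩ | ⟨x, y, z, rfl, hx, hy, hz, h⟩
    · obtain ⟨a', ha', e⟩ := exists_rename_input s x y z hp P
      obtain ⟨b, hb, e'⟩ := PiCalc.Proc.exists_subst_inp s x y P.decode
      rw [e]
      change PiCalc.Proc.Alpha (.inp (s x) a' (P.rename (Function.update s y a')).decode)
        ((PiCalc.Proc.inp x y P.decode).subst s)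
      rw [e']
      refine (PiCalc.Proc.Alpha.inp _ _ (ih h _)).trans
        (PiCalc.Proc.alpha_inp_subst (fun y hy => ha' y ?_) hb fun _ _ => rfl)
      exact Finset.erase_subset_erase _ (fun x hx => (h.mem_fn_decode hx).1) hy
    · obtain ⟨z', -, e⟩ := exists_rename_output s x y z hp P
      rw [e]
      refine .out _ _ ((ih h _).trans (PiCalc.Proc.alpha_subst_of_eqOn fun w hw => ?_))
      have : w ≠ z := fun e => (h.mem_fn_decode hw).2 e
      simp [this]

theorem alpha_input_rename {P : Proc N} {s : N → N} {x y z b d : N}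
    (hb : ∀ w ∈ P.fn.erase y, b ≠ s w) (hd : ∀ w ∈ P.fn.erase y, d ≠ s w) :
    Alpha
      (case (inputPattern (s x) b (s z)) (inputPattern_nodup _ _ _)
        (P.rename (Function.update s y b)))
      (case (inputPattern (s x) d (s z)) (inputPattern_nodup _ _ _)
        (P.rename (Function.update s y d))) := by
  have e : (inputPattern x y z).bn = [y] := rfl
  have := alpha_case_rename (p := inputPattern x y z) (P := P) (s := s) (F := fun _ => b)
    (G := fun _ => d) (by simp [e]) (by simp [e])
    (fun _ _ w hw hwy => hb w (by simpa [e, hw] using hwy))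
    (fun _ _ w hw hwy => hd w (by simpa [e, hw] using hwy))
    (inputPattern_nodup _ _ _) (inputPattern_nodup _ _ _)
  simp only [e, override_singleton] at this
  exact this

theorem alpha_output_rename {P : Proc N} {s : N → N} {x y z b d : N}
    (hb : ∀ w ∈ P.fn.erase z, b ≠ s w) (hd : ∀ w ∈ P.fn.erase z, d ≠ s w) :
    Alpha
      (case (outputPattern (s x) (s y) b) (outputPattern_nodup _ _ _)
        (P.rename (Function.update s z b)))
      (case (outputPattern (s x) (s y) d) (outputPattern_nodup _ _ _)
        (P.rename (Function.update s z d))) := by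
  have e : (outputPattern x y z).bn = [z] := rfl
  have := alpha_case_rename (p := outputPattern x y z) (P := P) (s := s) (F := fun _ => b)
    (G := fun _ => d) (by simp [e]) (by simp [e])
    (fun _ _ w hw hwz => hb w (by simpa [e, hw] using hwz))
    (fun _ _ w hw hwz => hd w (by simpa [e, hw] using hwz))
    (outputPattern_nodup _ _ _) (outputPattern_nodup _ _ _)
  simp only [e, override_singleton] at this
  exact this

omit [Infinite N] in
theorem exists_unify_input_output (x y z y' z' : N) :
    ∃ σ ρ : PSubst N, unify (inputPattern x y z) (outputPattern x y' z') = some (σ, ρ) := by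
  simp [inputPattern, outputPattern, unify, Pattern.toComm?]

omit [Infinite N] in
theorem unify_input_output {x y z x' y' z' : N} {σ ρ : PSubst N}
    (h : unify (inputPattern x y z) (outputPattern x' y' z') = some (σ, ρ)) :
    x = x' ∧ (σ.total = fun m => .var (Function.update id y y' m)) ∧
      ρ.total = fun m => .var (Function.update id z' z m) := by
  by_cases hx : x = x'
  · subst hx
    simp [inputPattern, outputPattern, unify, Pattern.toComm?] at h
    obtain ⟨rfl, rfl⟩ := h
    refine ⟨rfl, ?_, ?_⟩
    · funext m
      by_cases hm : m = y
      · simp [PSubst.total, PSubst.union, PSubst.empty, PSubst.single, hm]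
      · simp [PSubst.total, PSubst.union, PSubst.empty, PSubst.single, hm]
    · funext m
      by_cases hm : m = z'
      · simp [PSubst.total, PSubst.union, PSubst.empty, PSubst.single, hm]
      · simp [PSubst.total, PSubst.union, PSubst.empty, PSubst.single, hm]
  · simp [inputPattern, outputPattern, unify, hx] at h

omit [Infinite N] in
theorem unify_output_input {x y z x' y' z' : N} {σ ρ : PSubst N}
    (h : unify (outputPattern x' y' z') (inputPattern x y z) = some (σ, ρ)) :
    x = x' ∧ (ρ.total = fun m => .var (Function.update id y y' m)) ∧
      σ.total = fun m => .var (Function.update id z' z m) := by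
  by_cases hx : x = x'
  · subst hx
    simp [inputPattern, outputPattern, unify, Pattern.toComm?] at h
    obtain ⟨rfl, rfl⟩ := h
    refine ⟨rfl, ?_, ?_⟩
    · funext m
      by_cases hm : m = y
      · simp [PSubst.total, PSubst.union, PSubst.empty, PSubst.single, hm]
      · simp [PSubst.total, PSubst.union, PSubst.empty, PSubst.single, hm]
    · funext m
      by_cases hm : m = z'
      · simp [PSubst.total, PSubst.union, PSubst.empty, PSubst.single, hm]
      · simp [PSubst.total, PSubst.union, PSubst.empty, PSubst.single, hm]
  · simp [inputPattern, outputPattern, unify, Ne.symm hx] at h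

-- In the middle a binding name meets a binding name, which is not communicable.
omit [Infinite N] in
theorem unify_input_input (x y z x' y' z' : N) :
    unify (inputPattern x y z) (inputPattern x' y' z') = none := by
  simp [inputPattern, unify, Pattern.toComm?]

-- Here the last positions clash. This is what the third component is for: without it, two outputs
-- of the same name on the same channel would unify.
omit [Infinite N] in
theorem unify_output_output (x y z x' y' z' : N) :
    unify (outputPattern x y z) (outputPattern x' y' z') = none := by
  simp [outputPattern, unify, Pattern.toComm?]

/-- A communication between an input and an output with sorted continuations. -/
theorem Sorted.communicate {c : Set N} {x y z y' z' : N} {P Q : Proc N} (hz : z ∈ c)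
    (hP : P.Sorted (c \ {y})) (hy' : y' ∉ c) (hQc : ∀ m ∈ Q.fn, m ∈ c → m = z')
    (hQ : Q.Sorted {z'}) :
    (P.rename (Function.update id y y')).Sorted c ∧
    (Q.rename (Function.update id z' z)).Sorted c ∧
    PiCalc.Proc.Red (.par (.inp x y P.decode) (.out x y' Q.decode))
      (.par (P.rename (Function.update id y y')).decode
        (Q.rename (Function.update id z' z)).decode) := by
  -- The received `y'` lies outside `c`, as `y` lies outside `c \ {y}`. In `Q` the name `z'` becomes
  -- `z ∈ c`, and no other free name of `Q` is in `c`.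
  refine ⟨hP.rename fun m hm => ?_, hQ.rename fun m hm => ?_, ?_⟩
  · by_cases hmy : m = y
    · simp [hmy, hy']
    · simp [hmy]
  · by_cases hmz : m = z'
    · simp [hmz, hz]
    · simp only [Set.mem_singleton_iff, hmz, false_iff, ne_eq, not_false_eq_true,
        Function.update_of_ne, id]
      exact fun h => hmz (hQc m hm h)
  -- Decoding erases `z'`, so the substitution of `z` for it is invisible in the π-calculus.
  · refine .struct (.refl _) (.comm x y y' P.decode Q.decode)
      (.alpha (.par (hP.decode_rename _).symm (.symm ((hQ.decode_rename _).trans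
        (PiCalc.Proc.alpha_subst_of_eqOn_id fun w hw => ?_)))))
    have : w ≠ z' := fun e => (hQ.mem_fn_decode hw).2 e
    simp [this]

/-- Subject reduction for the sort discipline: of the four pairs of prefixes, only an input with an
output can communicate, and the decodings then communicate as well. -/
theorem Red.sorted_decode {T U : Proc N} (h : Red T U) {c : Set N} (hT : T.Sorted c) :
    U.Sorted c ∧ PiCalc.Proc.Red T.decode U.decode := by
  induction h generalizing c with
  | comm p q hp hq P Q σ ρ hu =>
    rcases hT with ⟨⟨x, y, z, rfl, hx, hz, hP⟩ | ⟨x, y, z, rfl, hx, hy, hPc, hP⟩,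
      ⟨x', y', z', rfl, hx', hz', hQ⟩ | ⟨x', y', z', rfl, hx', hy', hQc, hQ⟩⟩
    · simp [unify_input_input] at hu
    · obtain ⟨rfl, e₁, e₂⟩ := unify_input_output hu
      rw [e₁, e₂]
      obtain ⟨h₁, h₂, h₃⟩ := Sorted.communicate (x := x) hz hP hy' hQc hQ
      exact ⟨⟨h₁, h₂⟩, h₃⟩
    · obtain ⟨rfl, e₁, e₂⟩ := unify_output_input hu
      rw [e₁, e₂]
      obtain ⟨h₁, h₂, h₃⟩ := Sorted.communicate (x := x') hz' hQ hy hPc hP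
      exact ⟨⟨h₂, h₁⟩, .struct (.par_comm _ _) h₃ (.par_comm _ _)⟩
    · simp [unify_output_output] at hu
  | par Q _ ih => exact ⟨⟨(ih hT.1).1, hT.2⟩, .par _ (ih hT.1).2⟩
  | res a _ ih =>
    obtain ⟨h₁, h₂⟩ := ih (c := c \ {a}) hT
    exact ⟨h₁, .res _ h₂⟩
  | struct h₁ _ h₂ ih =>
    have hQ := (h₁.sorted_decode c).1.1 hT
    obtain ⟨hQ', hr⟩ := ih hQ
    exact ⟨(h₂.sorted_decode c).1.1 hQ',
      .struct ((h₁.sorted_decode c).2 hT) hr ((h₂.sorted_decode c).2 hQ')⟩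

end CPC.Proc

/-! ### The translation: sortedness, decoding and substitution. -/

namespace PiCalc.Proc

/-- All names of a process, bound ones included. -/
def names {N : Type u} [DecidableEq N] : Proc N → Finset N
  | nil => ∅
  | par P Q => P.names ∪ Q.names
  | rep P => P.names
  | res a P => insert a P.names
  | inp a b P => insert a (insert b P.names)
  | out a b P => insert a (insert b P.names)
  | ok => ∅

end PiCalc.Proc

section Translation

variable {N : Type u} [DecidableEq N] {f : N → N} {n : N}

theorem mem_fn_piToCPC {S : PiCalc.Proc N} {m : N} (hm : m ∈ (piToCPC f n S).fn) :
    m = n ∨ ∃ a ∈ S.fn, m = f a := by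
  induction S with
  | nil => simp [piToCPC, CPC.Proc.fn] at hm
  | ok => simp [piToCPC, CPC.Proc.fn] at hm
  | par P Q ihP ihQ =>
    rcases Finset.mem_union.1 hm with hm | hm
    · exact (ihP hm).imp_right fun ⟨a, ha, e⟩ => ⟨a, Finset.mem_union_left _ ha, e⟩
    · exact (ihQ hm).imp_right fun ⟨a, ha, e⟩ => ⟨a, Finset.mem_union_right _ ha, e⟩
  | rep P ih => exact ih hm
  | res b P ih =>
    obtain ⟨hb, hm⟩ := Finset.mem_erase.1 hm
    refine (ih hm).imp_right ?_
    rintro ⟨a, ha, rfl⟩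
    exact ⟨a, Finset.mem_erase.2 ⟨fun e => hb (e ▸ rfl), ha⟩, rfl⟩
  | inp x y P ih =>
    rw [piToCPC, CPC.Proc.mem_fn_input] at hm
    rcases hm with rfl | rfl | ⟨hm, hy⟩
    · exact .inr ⟨x, by simp [PiCalc.Proc.fn], rfl⟩
    · exact .inl rfl
    · refine (ih hm).imp_right ?_
      rintro ⟨a, ha, rfl⟩
      exact ⟨a, Finset.mem_insert_of_mem
        (Finset.mem_erase.2 ⟨fun e => hy (e ▸ rfl), ha⟩), rfl⟩
  | out x y P ih =>
    rw [piToCPC, CPC.Proc.mem_fn_output] at hm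
    rcases hm with rfl | rfl | ⟨hm, -⟩
    · exact .inr ⟨x, by simp [PiCalc.Proc.fn], rfl⟩
    · exact .inr ⟨y, by simp [PiCalc.Proc.fn], rfl⟩
    · refine (ih hm).imp_right ?_
      rintro ⟨a, ha, rfl⟩
      exact ⟨a, by simp [PiCalc.Proc.fn, ha], rfl⟩

theorem notMem_fn_piToCPC (hf : Function.Injective f) (hn : n ∉ Set.range f)
    {S : PiCalc.Proc N} {a : N} (ha : a ∉ S.fn) : f a ∉ (piToCPC f n S).fn := by
  intro h
  rcases mem_fn_piToCPC h with h | ⟨b, hb, e⟩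
  · exact hn ⟨a, h⟩
  · exact ha (hf e ▸ hb)

omit [DecidableEq N] in
theorem piToCPC_perm {π κ : Equiv.Perm N} (h : ∀ x, κ (f x) = f (π x)) (hκ : κ n = n)
    (S : PiCalc.Proc N) : piToCPC f n (S.perm π) = (piToCPC f n S).perm κ := by
  induction S with
  | nil => rfl
  | ok => rfl
  | par P Q ihP ihQ => exact congrArg₂ _ ihP ihQ
  | rep P ih => exact congrArg _ ih
  | res a P ih => simp [piToCPC, PiCalc.Proc.perm, CPC.Proc.perm, ih, h]
  | inp a b P ih =>
    refine CPC.Proc.case_congr ?_ ih _ _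
    rw [← h, ← h]
    conv_lhs => rw [← hκ]
    rfl
  | out a b P ih =>
    refine CPC.Proc.case_congr ?_ ih _ _
    rw [← h, ← h]
    conv_lhs => rw [← hκ]
    rfl

theorem piToCPC_perm_swap (hf : Function.Injective f) (hn : n ∉ Set.range f) (a c : N)
    (S : PiCalc.Proc N) : piToCPC f n (S.perm (Equiv.swap a c)) =
      (piToCPC f n S).perm (Equiv.swap (f a) (f c)) := by
  refine piToCPC_perm (fun x => hf.swap_apply a c x) ?_ S
  exact Equiv.swap_apply_of_ne_of_ne (fun e => hn ⟨a, e.symm⟩) fun e => hn ⟨c, e.symm⟩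

theorem PiCalc.Proc.Alpha.piToCPC (hf : Function.Injective f) (hn : n ∉ Set.range f)
    {S S' : PiCalc.Proc N} (h : S.Alpha S') : (piToCPC f n S).Alpha (piToCPC f n S') := by
  induction h with
  | refl P => exact .refl _
  | symm _ ih => exact ih.symm
  | trans _ _ ih₁ ih₂ => exact ih₁.trans ih₂
  | par _ _ ih₁ ih₂ => exact .par ih₁ ih₂
  | rep _ ih => exact .rep ih
  | res a _ ih => exact .res _ ih
  | inp a b _ ih => exact .case _ _ ih
  | out a b _ ih => exact .case _ _ ih
  | rename_res a c P hc =>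
    simp only [_root_.piToCPC]
    rw [piToCPC_perm_swap hf hn]
    exact .rename_res _ _ _ (notMem_fn_piToCPC hf hn hc)
  | rename_inp a b c P hc =>
    simp only [_root_.piToCPC]
    rw [piToCPC_perm_swap hf hn]
    refine CPC.Proc.Alpha.case_rebind (κ := Equiv.swap (f b) (f c)) (fun x hx hxb => ?_) ?_
      (.refl _)
    · refine Equiv.swap_apply_of_ne_of_ne ?_ ?_
      · simpa [inputPattern, CPC.Pattern.bn] using hxb
      · exact fun e => notMem_fn_piToCPC hf hn hc (e ▸ hx)
    · change inputPattern (f a) (Equiv.swap (f b) (f c) (f b)) n = _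
      rw [Equiv.swap_apply_left]

theorem PiCalc.Proc.SEquiv.piToCPC (hf : Function.Injective f) (hn : n ∉ Set.range f)
    {S S' : PiCalc.Proc N} (h : S.SEquiv S') : (piToCPC f n S).SEquiv (piToCPC f n S') := by
  induction h with
  | alpha h => exact .alpha (h.piToCPC hf hn)
  | symm _ ih => exact ih.symm
  | trans _ _ ih₁ ih₂ => exact ih₁.trans ih₂
  | par _ _ ih₁ ih₂ => exact .par ih₁ ih₂
  | rep _ ih => exact .rep ih
  | res a _ ih => exact .res _ ih
  | inp a b _ ih => exact .case _ _ ih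
  | out a b _ ih => exact .case _ _ ih
  | par_nil => exact .par_nil _
  | par_comm => exact .par_comm _ _
  | par_assoc => exact .par_assoc _ _ _
  | rep_unfold => exact .rep_unfold _
  | res_nil => exact .res_nil _
  | res_comm => exact .res_comm _ _ _
  | extrude a P Q ha => exact .extrude _ _ _ (notMem_fn_piToCPC hf hn ha)

theorem sorted_piToCPC (hn : n ∉ Set.range f) (S : PiCalc.Proc N) :
    (piToCPC f n S).Sorted {n} := by
  have hf : ∀ a, f a ∉ ({n} : Set N) := fun a e => hn ⟨a, e⟩
  have hd : ∀ a, ({n} : Set N) \ {f a} = {n} := fun a =>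
    Set.sdiff_singleton_eq_self (hf a)
  induction S with
  | nil => trivial
  | ok => trivial
  | par P Q ihP ihQ => exact ⟨ihP, ihQ⟩
  | rep P ih => exact ih
  | res a P ih =>
    change (piToCPC f n P).Sorted ({n} \ {f a})
    rwa [hd]
  | inp a b P ih => exact .inl ⟨_, _, _, rfl, hf a, rfl, by rwa [hd]⟩
  | out a b P ih => exact .inr ⟨_, _, _, rfl, hf a, hf b, fun _ _ h => h, ih⟩

/-- Since `f` need not be surjective, a permutation stands in for it, so that the renaming can be
undone. Agreement on bound names as well makes this an equality. -/
theorem decode_piToCPC {S : PiCalc.Proc N} {π : Equiv.Perm N} (h : ∀ x ∈ S.names, π x = f x) :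
    (piToCPC f n S).decode = S.perm π := by
  induction S with
  | nil => rfl
  | ok => rfl
  | par P Q ihP ihQ =>
    exact congrArg₂ _ (ihP fun x hx => h x (Finset.mem_union_left _ hx))
      (ihQ fun x hx => h x (Finset.mem_union_right _ hx))
  | rep P ih => exact congrArg _ (ih h)
  | res a P ih =>
    have e := ih fun x hx => h x (Finset.mem_insert_of_mem hx)
    simp [piToCPC, CPC.Proc.decode, PiCalc.Proc.perm, e, h a (by simp [PiCalc.Proc.names])]
  | inp a b P ih =>
    have e := ih fun x hx => h x (by simp [PiCalc.Proc.names, hx])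
    simp [piToCPC, CPC.Proc.decode, PiCalc.Proc.perm, e, h a (by simp [PiCalc.Proc.names]),
      h b (by simp [PiCalc.Proc.names]), inputPattern]
  | out a b P ih =>
    have e := ih fun x hx => h x (by simp [PiCalc.Proc.names, hx])
    simp [piToCPC, CPC.Proc.decode, PiCalc.Proc.perm, e, h a (by simp [PiCalc.Proc.names]),
      h b (by simp [PiCalc.Proc.names]), outputPattern]
theorem ne_of_mem_fn_piToCPC (hf : Function.Injective f) (hn : n ∉ Set.range f)
    {P : PiCalc.Proc N} {a a' : N} {s t : N → N} (ht : t n = n)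
    (h : ∀ x ∈ P.fn.erase a, t (f x) = f (s x)) (ha' : ∀ y ∈ P.fn.erase a, a' ≠ s y) :
    ∀ y ∈ (piToCPC f n P).fn.erase (f a), f a' ≠ t y := by
  intro y hy e
  obtain ⟨hya, hy⟩ := Finset.mem_erase.1 hy
  rcases mem_fn_piToCPC hy with rfl | ⟨b, hb, rfl⟩
  · exact hn ⟨a', e.trans ht⟩
  · have hb' : b ∈ P.fn.erase a := Finset.mem_erase.2 ⟨fun e => hya (e ▸ rfl), hb⟩
    rw [h b hb'] at e
    exact ha' b hb' (hf e)

theorem update_apply_injective (hf : Function.Injective f) {A : Finset N} {a a' : N}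
    {s t : N → N} (h : ∀ x ∈ A.erase a, t (f x) = f (s x)) :
    ∀ x ∈ A, Function.update t (f a) (f a') (f x) = f (Function.update s a a' x) := by
  intro x hx
  by_cases hxa : x = a
  · simp [hxa]
  · rw [Function.update_of_ne (hf.ne hxa), Function.update_of_ne hxa]
    exact h x (by simp [hx, hxa])

variable [Infinite N]

/-- Agreement is asked only on free names, so that it survives the updates made under binders. As
`s` need not be injective, this covers communication and both cases of name invariance. -/
theorem piToCPC_subst (hf : Function.Injective f) (hn : n ∉ Set.range f) {S : PiCalc.Proc N}
    {s t : N → N} (h : ∀ x ∈ S.fn, t (f x) = f (s x)) (ht : t n = n) :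
    (piToCPC f n (S.subst s)).Alpha ((piToCPC f n S).rename t) := by
  have hne : ∀ a, n ≠ f a := fun a e => hn ⟨a, e.symm⟩
  induction S generalizing s t with
  | nil => exact .refl _
  | par P Q ihP ihQ =>
    exact .par (ihP (fun x hx => h x (Finset.mem_union_left _ hx)) ht)
      (ihQ (fun x hx => h x (Finset.mem_union_right _ hx)) ht)
  | rep P ih => exact .rep (ih h ht)
  | ok => exact .refl _
  | res a P ih =>
    obtain ⟨b, hb, e⟩ := PiCalc.Proc.exists_subst_res s a P
    obtain ⟨c, hc, e'⟩ := CPC.Proc.exists_rename_res t (f a) (piToCPC f n P)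
    rw [e, piToCPC, piToCPC, e']
    exact (CPC.Proc.Alpha.res _ (ih (update_apply_injective hf h)
      (by rw [Function.update_of_ne (hne a), ht]))).trans
      (CPC.Proc.alpha_res_rename (ne_of_mem_fn_piToCPC hf hn ht h hb) hc)
  | inp d a P ih =>
    have h' : ∀ x ∈ P.fn.erase a, t (f x) = f (s x) := fun x hx =>
      h x (Finset.mem_insert_of_mem hx)
    obtain ⟨b, hb, e⟩ := PiCalc.Proc.exists_subst_inp s d a P
    obtain ⟨c, hc, e'⟩ := CPC.Proc.exists_rename_input t (f d) (f a) n
      (inputPattern_nodup _ _ _) (piToCPC f n P)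
    have ih' := (CPC.Proc.Alpha.case (inputPattern (f (s d)) (f b) n) (inputPattern_nodup _ _ _)
      (ih (update_apply_injective (a' := b) hf h')
        (by rw [Function.update_of_ne (hne a), ht])))
    rw [e, piToCPC, piToCPC, e']
    have := CPC.Proc.alpha_input_rename (x := f d) (z := n)
      (ne_of_mem_fn_piToCPC hf hn ht h' hb) hc
    simp only [ht, h d (by simp [PiCalc.Proc.fn])] at this ⊢
    exact ih'.trans this
  | out a b P ih =>
    obtain ⟨c, hc, e⟩ := CPC.Proc.exists_rename_output t (f a) (f b) n
      (outputPattern_nodup _ _ _) (piToCPC f n P)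
    have h' : ∀ x ∈ P.fn, t (f x) = f (s x) := fun x hx => h x (by simp [PiCalc.Proc.fn, hx])
    have ih' := (CPC.Proc.Alpha.case (outputPattern (f (s a)) (f (s b)) n)
      (outputPattern_nodup _ _ _) (ih h' ht))
    -- Renaming replaces the binder `λ n` by a fresh one, but keeping `n` is also admissible: `t`
    -- maps the other free names into the range of `f`.
    have hfresh : ∀ w ∈ (piToCPC f n P).fn.erase n, n ≠ t w := by
      intro w hw e
      obtain ⟨hwn, hw⟩ := Finset.mem_erase.1 hw
      rcases mem_fn_piToCPC hw with rfl | ⟨x, hx, rfl⟩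
      · exact hwn rfl
      · exact hne _ (e.trans (h' x hx))
    have := CPC.Proc.alpha_output_rename (x := f a) (y := f b) hfresh hc
    rw [piToCPC, e]
    have e₁ : Function.update t n n = t := Function.update_eq_self_iff.2 ht.symm
    simp only [e₁, h a (by simp [PiCalc.Proc.fn]), h b (by simp [PiCalc.Proc.fn])] at this ⊢
    exact ih'.trans this

/-! ### Operational correspondence, divergence and success. -/

theorem PiCalc.Proc.Red.piToCPC (hf : Function.Injective f) (hn : n ∉ Set.range f)
    {S S' : PiCalc.Proc N} (h : S.Red S') : (piToCPC f n S).Red (piToCPC f n S') := by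
  induction h with
  | comm a b c P Q =>
    obtain ⟨σ, ρ, hu⟩ := CPC.Proc.exists_unify_input_output (f a) (f b) n (f c) n
    obtain ⟨-, e₁, e₂⟩ := CPC.Proc.unify_input_output hu
    have hred := CPC.Proc.Red.comm _ _ (inputPattern_nodup _ _ _) (outputPattern_nodup _ _ _)
      (_root_.piToCPC f n P) (_root_.piToCPC f n Q) σ ρ hu
    rw [e₁, e₂] at hred
    refine .struct (.refl _) hred (.alpha (.par (.symm (piToCPC_subst hf hn ?_ ?_)) ?_))
    · exact fun x hx => update_apply_injective hf (s := id) (t := id) (fun _ _ => rfl) x hx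
    · exact Function.update_of_ne (fun e => hn ⟨b, e.symm⟩) _ _
    -- The output receives `n` for its binding name `n`: an identity substitution, which only
    -- refreshes bound names.
    · refine .trans (.symm (piToCPC_subst (s := id) hf hn ?_ ?_))
        ((PiCalc.Proc.alpha_subst_of_eqOn_id fun _ _ => rfl).piToCPC hf hn)
      · exact fun x _ => congrFun (Function.update_eq_self n id) (f x)
      · exact congrFun (Function.update_eq_self n id) n
  | par Q _ ih => exact .par _ ih
  | res a _ ih => exact .res _ ih
  | struct h₁ _ h₂ ih => exact .struct (h₁.piToCPC hf hn) ih (h₂.piToCPC hf hn)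

omit [DecidableEq N] in
theorem exists_apply_notMem (hf : Function.Injective f) (A : Finset N) : ∃ b, f b ∉ A := by
  obtain ⟨_, ⟨b, rfl⟩, hb⟩ := (Set.infinite_range_of_injective hf).exists_notMem_finset A
  exact ⟨b, hb⟩

/-- A sorted process is alpha-equivalent to the translation of some process. -/
theorem exists_alpha_piToCPC_perm (hf : Function.Injective f) (hn : n ∉ Set.range f)
    (T : CPC.Proc N) (π : Equiv.Perm N) (hT : (T.perm π).Sorted {n})
    (hr : ∀ x ∈ (T.perm π).decode.fn, x ∈ Set.range f) :
    ∃ R, (T.perm π).Alpha (piToCPC f n R) := by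
  -- The bound name is moved before the induction hypothesis is used, so the statement must hold for
  -- all permuted copies of a subterm.
  induction T generalizing π with
  | nil => exact ⟨.nil, .refl _⟩
  | ok => exact ⟨.ok, .refl _⟩
  | rep P ih =>
    obtain ⟨R, hR⟩ := ih π hT hr
    exact ⟨.rep R, .rep hR⟩
  | par P Q ihP ihQ =>
    obtain ⟨R, hR⟩ := ihP π hT.1 fun x hx => hr x (Finset.mem_union_left _ hx)
    obtain ⟨R', hR'⟩ := ihQ π hT.2 fun x hx => hr x (Finset.mem_union_right _ hx)
    exact ⟨.par R R', .par hR hR'⟩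
  | res a P ih =>
    -- The bound name is moved to an unused name in the range of `f`.
    obtain ⟨b, hb⟩ := exists_apply_notMem hf (P.perm π).fn
    have hT' : (P.perm π).Sorted ({n} \ {π a}) := hT
    obtain ⟨R, hR⟩ := ih (Equiv.swap (π a) (f b) * π)
      (by
        rw [← CPC.Proc.perm_perm]
        refine hT'.perm fun x hx => ?_
        have hxb : x ≠ f b := fun e => hb (e ▸ hx)
        by_cases hxa : x = π a
        · simpa [hxa] using fun e => hn ⟨b, e⟩
        · simp [Equiv.swap_apply_of_ne_of_ne hxa hxb, hxa])
      (by
        rw [← CPC.Proc.perm_perm, hT'.decode_perm, PiCalc.Proc.fn_perm]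
        intro x hx
        obtain ⟨w, hw, rfl⟩ := Finset.mem_image.1 hx
        have hwb : w ≠ f b := fun e => hb (e ▸ (hT'.mem_fn_decode hw).1)
        by_cases hwa : w = π a
        · simp [hwa]
        · rw [Equiv.swap_apply_of_ne_of_ne hwa hwb]
          exact hr w (Finset.mem_erase.2 ⟨hwa, hw⟩))
    rw [← CPC.Proc.perm_perm] at hR
    exact ⟨.res b R, (CPC.Proc.Alpha.rename_res _ _ _ hb).trans (.res _ hR)⟩
  | case p hp P ih =>
    rcases hT with ⟨x, y, z, hpat, hx, hz, hT'⟩ | ⟨x, y, z, hpat, hx, hy, hz, hT'⟩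
    · rw [CPC.Proc.perm, CPC.Proc.case_congr hpat rfl _ (inputPattern_nodup _ _ _)] at hr ⊢
      obtain rfl : z = n := hz
      have hr' : ∀ w ∈ (P.perm π).decode.fn, w ≠ y → w ∈ Set.range f := fun w hw hwy =>
        hr w (Finset.mem_insert_of_mem (Finset.mem_erase.2 ⟨hwy, hw⟩))
      obtain ⟨a, rfl⟩ := hr x (Finset.mem_insert_self _ _)
      obtain ⟨b, hb⟩ := exists_apply_notMem hf (P.perm π).fn
      obtain ⟨R, hR⟩ := ih (Equiv.swap y (f b) * π)
        (by
          rw [← CPC.Proc.perm_perm]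
          refine hT'.perm fun x hx => ?_
          have hxb : x ≠ f b := fun e => hb (e ▸ hx)
          by_cases hxa : x = y
          · simpa [hxa] using fun e => hn ⟨b, e⟩
          · simp [Equiv.swap_apply_of_ne_of_ne hxa hxb, hxa])
        (by
          rw [← CPC.Proc.perm_perm, hT'.decode_perm, PiCalc.Proc.fn_perm]
          intro x hx
          obtain ⟨w, hw, rfl⟩ := Finset.mem_image.1 hx
          have hwb : w ≠ f b := fun e => hb (e ▸ (hT'.mem_fn_decode hw).1)
          by_cases hwa : w = y
          · simp [hwa]
          · rw [Equiv.swap_apply_of_ne_of_ne hwa hwb]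
            exact hr' w hw hwa)
      rw [← CPC.Proc.perm_perm] at hR
      refine ⟨.inp a b R, CPC.Proc.Alpha.case_rebind (fun w hw hwy => ?_) ?_ hR⟩
      · exact Equiv.swap_apply_of_ne_of_ne
          (by simpa [inputPattern, CPC.Pattern.bn] using hwy) fun e => hb (e ▸ hw)
      · change inputPattern (f a) (Equiv.swap y (f b) y) z = _
        rw [Equiv.swap_apply_left]
    · rw [CPC.Proc.perm, CPC.Proc.case_congr hpat rfl _ (outputPattern_nodup _ _ _)] at hr ⊢
      obtain ⟨a, rfl⟩ := hr x (Finset.mem_insert_self _ _)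
      obtain ⟨b, rfl⟩ := hr y (Finset.mem_insert_of_mem (Finset.mem_insert_self _ _))
      have hr' : ∀ w ∈ (P.perm π).decode.fn, w ∈ Set.range f := fun w hw =>
        hr w (Finset.mem_insert_of_mem (Finset.mem_insert_of_mem hw))
      -- The binder of an output is moved back to `n`. By sortedness `n` is not free in the
      -- continuation unless it is `z`, so nothing else moves.
      have hfix : ∀ w ∈ (P.perm π).fn, w ≠ z → Equiv.swap z n w = w := fun w hw hwz =>
        Equiv.swap_apply_of_ne_of_ne hwz fun e => hwz (hz w hw e)
      obtain ⟨R, hR⟩ := ih (Equiv.swap z n * π)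
        (by
          rw [← CPC.Proc.perm_perm]
          refine hT'.perm fun x hx => ?_
          by_cases hxz : x = z
          · simp [hxz]
          · simpa [hfix x hx hxz, hxz] using fun e : x = n => hxz (hz x hx e))
        (by
          rw [← CPC.Proc.perm_perm, hT'.decode_perm, PiCalc.Proc.fn_perm]
          intro x hx
          obtain ⟨w, hw, rfl⟩ := Finset.mem_image.1 hx
          have hw' := hT'.mem_fn_decode hw
          rw [hfix w hw'.1 hw'.2]
          exact hr' w hw)
      rw [← CPC.Proc.perm_perm] at hR
      refine ⟨.out a b R, CPC.Proc.Alpha.case_rebind (fun w hw hwz => ?_) ?_ hR⟩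
      · exact hfix w hw (by simpa [outputPattern, CPC.Pattern.bn] using hwz)
      · change outputPattern (f a) (f b) (Equiv.swap z n z) = _
        rw [Equiv.swap_apply_left]

/-- Every reduction of a translation is the translation of a reduction. -/
theorem exists_red_of_red_piToCPC (hf : Function.Injective f) (hn : n ∉ Set.range f)
    {S : PiCalc.Proc N} {T : CPC.Proc N} (h : (piToCPC f n S).Red T) :
    ∃ R, S.Red R ∧ T.Alpha (piToCPC f n R) := by
  obtain ⟨hT, hred⟩ := h.sorted_decode (sorted_piToCPC hn S)
  have hr : ∀ x ∈ T.decode.fn, x ∈ Set.range f := by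
    intro x hx
    rcases mem_fn_piToCPC ((sorted_piToCPC hn S).mem_fn_decode (hred.fn_subset hx)).1 with
      rfl | ⟨a, -, rfl⟩
    · exact (((sorted_piToCPC hn S).mem_fn_decode (hred.fn_subset hx)).2 rfl).elim
    · exact ⟨a, rfl⟩
  obtain ⟨R, hR⟩ := exists_alpha_piToCPC_perm hf hn T 1 (by rwa [CPC.Proc.perm_one])
    (by rwa [CPC.Proc.perm_one])
  rw [CPC.Proc.perm_one] at hR
  -- A single permutation for both `S` and `R`: the decoded reduction runs from `S.perm π` to
  -- `R.perm π`, and `π⁻¹` brings it back.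
  obtain ⟨π, hπ⟩ := hf.exists_perm_eqOn (S.names ∪ R.names)
  have h₁ : (piToCPC f n S).decode = S.perm π :=
    decode_piToCPC fun x hx => hπ x (Finset.mem_union_left _ hx)
  have h₂ : (piToCPC f n R).decode = R.perm π :=
    decode_piToCPC fun x hx => hπ x (Finset.mem_union_right _ hx)
  have h₃ := (hR.sorted_decode {n}).2 hT
  rw [h₁] at hred
  rw [h₂] at h₃
  have := (PiCalc.Proc.Red.struct (.refl _) hred (.alpha h₃)).perm π⁻¹
  rw [PiCalc.Proc.perm_perm, PiCalc.Proc.perm_perm, inv_mul_cancel, PiCalc.Proc.perm_one,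
    PiCalc.Proc.perm_one] at this
  exact ⟨R, this, hR⟩

theorem exists_red_of_sequiv_red (hf : Function.Injective f) (hn : n ∉ Set.range f)
    {S : PiCalc.Proc N} {T U : CPC.Proc N} (hT : T.SEquiv (piToCPC f n S)) (h : T.Red U) :
    ∃ R, S.Red R ∧ U.SEquiv (piToCPC f n R) := by
  obtain ⟨R, hR, hU⟩ := exists_red_of_red_piToCPC hf hn (.struct hT.symm h (.refl U))
  exact ⟨R, hR, .alpha hU⟩

theorem PiCalc.Proc.Reds.piToCPC (hf : Function.Injective f) (hn : n ∉ Set.range f)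
    {S S' : PiCalc.Proc N} (h : S.Reds S') : (piToCPC f n S).Reds (piToCPC f n S') := by
  induction h with
  | refl => exact .refl
  | tail _ h ih => exact ih.tail (h.piToCPC hf hn)

theorem exists_reds_of_reds_piToCPC (hf : Function.Injective f) (hn : n ∉ Set.range f)
    {S : PiCalc.Proc N} {T : CPC.Proc N} (h : (piToCPC f n S).Reds T) :
    ∃ R, S.Reds R ∧ T.SEquiv (piToCPC f n R) := by
  induction h with
  | refl => exact ⟨S, .refl, .refl _⟩
  | tail _ h ih =>
    obtain ⟨R, hR, hT⟩ := ih
    obtain ⟨R', hR', hU⟩ := exists_red_of_sequiv_red hf hn hT h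
    exact ⟨R', hR.tail hR', hU⟩

theorem diverges_of_diverges_piToCPC (hf : Function.Injective f) (hn : n ∉ Set.range f)
    {S : PiCalc.Proc N} (h : Diverges CPC.Proc.Red (piToCPC f n S)) :
    Diverges PiCalc.Proc.Red S := by
  obtain ⟨g, hg, hr⟩ := h
  -- The subtype carries the invariant along the sequence, so that source reducts can be chosen one
  -- at a time.
  have hstep (i : ℕ) (R : {R // (g i).SEquiv (piToCPC f n R)}) :
      ∃ R' : {R // (g (i + 1)).SEquiv (piToCPC f n R)}, R.1.Red R'.1 := by
    obtain ⟨R', h₁, h₂⟩ := exists_red_of_sequiv_red hf hn R.2 (hr i)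
    exact ⟨⟨R', h₂⟩, h₁⟩
  choose next hnext using hstep
  let seq (i : ℕ) : {R // (g i).SEquiv (piToCPC f n R)} :=
    Nat.rec ⟨S, hg ▸ .refl _⟩ next i
  exact ⟨fun i => (seq i).1, rfl, fun i => hnext i (seq i)⟩

omit [Infinite N] in
theorem exists_sequiv_ok_of_piToCPC (hf : Function.Injective f) (hn : n ∉ Set.range f)
    {R : PiCalc.Proc N} (h : (piToCPC f n R).HasOk) :
    ∃ R', R.SEquiv (.par R' .ok) := by
  obtain ⟨T, hT⟩ := h
  obtain ⟨π, hπ⟩ := hf.exists_perm_eqOn R.names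
  have h := (hT.sorted_decode {n}).2 (sorted_piToCPC hn R)
  rw [decode_piToCPC hπ] at h
  have := h.perm π⁻¹
  rw [PiCalc.Proc.perm_perm, inv_mul_cancel, PiCalc.Proc.perm_one] at this
  exact ⟨_, this⟩

theorem succeeds_piToCPC_iff (hf : Function.Injective f) (hn : n ∉ Set.range f)
    (S : PiCalc.Proc N) : S.Succeeds ↔ (piToCPC f n S).Succeeds := by
  constructor
  · rintro ⟨P, P', h, h'⟩
    exact ⟨_, h.piToCPC hf hn, _, h'.piToCPC hf hn⟩
  · rintro ⟨T, h, T', hT'⟩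
    obtain ⟨R, hR, hT⟩ := exists_reds_of_reds_piToCPC hf hn h
    obtain ⟨R', hR'⟩ := exists_sequiv_ok_of_piToCPC hf hn ⟨T', hT.symm.trans hT'⟩
    exact ⟨R, R', hR, hR'⟩

/-! ### Name invariance, compositionality and the theorem. -/

omit [DecidableEq N] [Infinite N] in
/-- The substitution on target names that corresponds to a substitution on source names. -/
theorem exists_isInducedSubst (hf : Function.Injective f) {σ : N → N}
    (hσ : {a | σ a ≠ a}.Finite) :
    ∃ τ : N → N, {m | τ m ≠ m}.Finite ∧ IsInducedSubst (fun a (_ : Fin 1) => f a) σ τ := by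
  refine ⟨Function.extend f (fun a => f (σ a)) id, (hσ.image f).subset ?_, ?_, ?_⟩
  · intro m hm
    by_cases h : ∃ a, f a = m
    · obtain ⟨a, rfl⟩ := h
      refine ⟨a, fun e => hm ?_, rfl⟩
      rw [hf.extend_apply, e]
    · exact (hm (Function.extend_apply' _ _ _ h)).elim
  · exact fun a _ => hf.extend_apply _ _ a
  · exact fun m hm => Function.extend_apply' _ _ _ fun ⟨a, e⟩ => hm a 0 e.symm

omit [DecidableEq N] [Infinite N] in
theorem piToCPC_compositional {j : ℕ} (op : PiCalc.Op N j) :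
    ∃ C : CPC.Ctx N j, C.IsContext ∧
      ∀ S : Fin j → PiCalc.Proc N, piToCPC f n (op.app S) = C.fill fun i => piToCPC f n (S i) := by
  cases op with
  | nil => exact ⟨.nil, fun i => i.elim0, fun _ => rfl⟩
  | ok => exact ⟨.ok, fun i => i.elim0, fun _ => rfl⟩
  | par =>
    refine ⟨.par (.hole 0) (.hole 1), fun i => ?_, fun _ => rfl⟩
    fin_cases i <;> simp [CPC.Ctx.count]
  | rep =>
    refine ⟨.rep (.hole 0), fun i => ?_, fun _ => rfl⟩
    simp [CPC.Ctx.count, Subsingleton.elim i 0]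
  | res a =>
    refine ⟨.res (f a) (.hole 0), fun i => ?_, fun _ => rfl⟩
    simp [CPC.Ctx.count, Subsingleton.elim i 0]
  | inp a b =>
    refine ⟨.case (inputPattern (f a) (f b) n) (inputPattern_nodup _ _ _) (.hole 0),
      fun i => ?_, fun _ => rfl⟩
    simp [CPC.Ctx.count, Subsingleton.elim i 0]
  | out a b =>
    refine ⟨.case (outputPattern (f a) (f b) n) (outputPattern_nodup _ _ _) (.hole 0),
      fun i => ?_, fun _ => rfl⟩
    simp [CPC.Ctx.count, Subsingleton.elim i 0]

theorem isConcurrentHom_piToCPC (hf : Function.Injective f) (hn : n ∉ Set.range f) :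
    IsConcurrentHom (piToCPC f n) (fun (a : N) (_ : Fin 1) => f a) where
  par _ _ := rfl
  valid :=
    { k_pos := Nat.one_pos
      alpha := fun _ _ h => h.piToCPC hf hn
      compositional := fun op _ => by
        obtain ⟨C, hC, h⟩ := piToCPC_compositional (f := f) (n := n) op
        exact ⟨C, hC, fun S _ => h S⟩
      name_invariant := fun σ hσ => by
        obtain ⟨τ, hτ, hind⟩ := exists_isInducedSubst hf hσ
        have hα (S : PiCalc.Proc N) :
            (piToCPC f n (S.subst σ)).Alpha ((piToCPC f n S).rename τ) :=
          piToCPC_subst hf hn (fun x _ => hind.1 x 0)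
            (hind.2 n fun a _ e => hn ⟨a, e.symm⟩)
        exact ⟨τ, hτ, hind, fun S =>
          ⟨fun _ => hα S, fun _ => CPC.Proc.SEquiv.bequiv (.alpha (hα S))⟩⟩
      complete := fun S S' h => ⟨_, h.piToCPC hf hn, CPC.Proc.SEquiv.bequiv (.refl _)⟩
      sound := fun S T h => by
        obtain ⟨R, hR, hT⟩ := exists_reds_of_reds_piToCPC hf hn h
        exact ⟨R, hR, T, .refl, hT.bequiv⟩
      divergence := fun S h => diverges_of_diverges_piToCPC hf hn h
      success := succeeds_piToCPC_iff hf hn }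

end Translation

theorem mainTheorem7 {N : Type u} [DecidableEq N] [Infinite N] :
    (∃ (f : N → N) (n : N), Function.Injective f ∧ n ∉ Set.range f ∧
      IsConcurrentHom (piToCPC f n) (fun (a : N) (_ : Fin 1) => f a)) ∧
    ∀ (f : N → N) (n : N), Function.Injective f → n ∉ Set.range f →
      IsConcurrentHom (piToCPC f n) (fun (a : N) (_ : Fin 1) => f a) := by
  refine ⟨?_, fun f n hf hn => isConcurrentHom_piToCPC hf hn⟩
  obtain ⟨n⟩ : Nonempty N := inferInstance
  -- `freshen {n}` is an injection of the names into the names other than `n`.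
  have hn : n ∉ Set.range (freshen {n}) := fun ⟨x, hx⟩ =>
    freshen_notMem {n} x (Finset.mem_singleton.2 hx)
  exact ⟨_, n, freshen_injective {n}, hn, isConcurrentHom_piToCPC (freshen_injective {n}) hn⟩
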